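/- Let $s\ge 1$ and $m$ be integers, $\Omega\subseteq\mathbb{R}^m$ open (e.g. $\Omega=\mathbb{R}^m$), and let $B:\Omega\to\mathbb{R}^{m\times m}$ be of class $C^s$ with $B(y)^\top=-B(y)$, and $H,C:\Omega\to\mathbb{R}$ of class $C^{s+1}$, where $C$ is a Casimir of $B$, i.e. $\nabla C(y)^\top B(y)=0$ for all $y\in\Omega$. Let $\tilde B\in\mathbb{R}^{m\times m}$ satisfy $\tilde B^\top=-\tilde B$. Let $y:[0,T]\to\Omega$, $T>0$, be the solution of the Poisson problem $$\dot y=B(y)\nabla H(y),\qquad y(0)=y_0 .$$ Let $P_j$ ($j\ge0$) be the orthonormal Legendre polynomials on $[0,1]$: $\deg P_j=j$, positive leading coefficient, $\int_0^1P_iP_j\,dc=\delta_{ij}$. For a step-size $h>0$ and a path $\sigma:[0,h]\to\Omega$ put $$\gamma_j(\sigma)=\int_0^1P_j(c)\nabla H(\sigma(ch))\,dc,\quad \pi_j(\sigma)=\int_0^1P_j(c)\nabla C(\sigma(ch))\,dc,\quad \rho_{ij}(\sigma)=\int_0^1P_i(c)P_j(c)B(\sigma(ch))\,dc .$$ Suppose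 that for all sufficiently small $h>0$ a number $\alpha=\alpha(h)$ and a path $\sigma_\alpha=\sigma_{\alpha,h}:[0,h]\to\Omega$ (necessarily a polynomial of degree at most $s$) satisfy $$\dot\sigma_\alpha(ch)=\sum_{i,j=0}^{s-1}P_i(c)\rho_{ij}(\sigma_\alpha)\gamma_j(\sigma_\alpha)-\alpha\tilde B\gamma_0(\sigma_\alpha),\quad c\in[0,1],\qquad \sigma_\alpha(0)=y_0,$$ where $\alpha$ is given by $$\alpha=\frac{\sum_{i,j=0}^{s-1}\pi_i(\sigma_\alpha)^\top\rho_{ij}(\sigma_\alpha)\gamma_j(\sigma_\alpha)}{\pi_0(\sigma_\alpha)^\top\tilde B\gamma_0(\sigma_\alpha)} .$$ Assume that, as $h\to0^+$, the paths $\sigma_\alpha$ stay in a fixed compact subset of $\Omega$ and the denominator is bounded away from zero: $|\pi_0(\sigma_\alpha)^\top\tilde B\gamma_0(\sigma_\alpha)|\ge\delta$ for some $\delta>0$ independent of $h$. Then $$\sigma_\alpha(h)-y(h)=O(h^{2s+1})\qquad (h\to0^+).$$ -/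

import Mathlib

open Filter Topology Asymptotics Set
open scoped Gradient InnerProductSpace

namespace PoissonHBVM

/-- The orthonormal Legendre polynomial of degree `j` on `[0,1]`, with positive leading
coefficient (Mathlib's `shiftedLegendre j` takes the value `1` at `0`), as a function of `c`. -/
noncomputable def legendreP (j : ℕ) (c : ℝ) : ℝ :=
  Real.sqrt (2 * (j : ℝ) + 1) * (-1) ^ j * Polynomial.aeval c (Polynomial.shiftedLegendre j)

variable {m : ℕ}

/-- The `j`-th Fourier coefficient `∫₀¹ P_j(c) ∇G(σ(ch)) dc` of the gradient of the scalar
function `G` along the path `σ : [0,h] → ℝᵐ`.  It is `γ_j(σ)` for the Hamiltonian `G = H` and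
`π_j(σ)` for the Casimir `G = C`. -/
noncomputable def gradCoeff (G : EuclideanSpace ℝ (Fin m) → ℝ) (j : ℕ) (h : ℝ)
    (σ : ℝ → EuclideanSpace ℝ (Fin m)) : EuclideanSpace ℝ (Fin m) :=
  ∫ c in (0 : ℝ)..1, legendreP j c • ∇ G (σ (c * h))

/-- The Fourier coefficient `ρ_{ij}(σ) = ∫₀¹ P_i(c) P_j(c) B(σ(ch)) dc`.  An `m × m` matrix is
regarded as a linear map on Euclidean space `ℝᵐ`, the transpose being the adjoint. -/
noncomputable def rhoCoeff
    (B : EuclideanSpace ℝ (Fin m) → EuclideanSpace ℝ (Fin m) →L[ℝ] EuclideanSpace ℝ (Fin m))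
    (i j : ℕ) (h : ℝ) (σ : ℝ → EuclideanSpace ℝ (Fin m)) :
    EuclideanSpace ℝ (Fin m) →L[ℝ] EuclideanSpace ℝ (Fin m) :=
  ∫ c in (0 : ℝ)..1, (legendreP i c * legendreP j c) • B (σ (c * h))

/-- `A` is skew-symmetric: `Aᵀ = -A`. -/
def IsSkew (A : EuclideanSpace ℝ (Fin m) →L[ℝ] EuclideanSpace ℝ (Fin m)) : Prop :=
  ContinuousLinearMap.adjoint A = -A

/-- `C` is a Casimir of `B` on `Ω`: `∇C(y)ᵀ B(y) = 0` for all `y ∈ Ω`. -/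
def IsCasimirOn
    (B : EuclideanSpace ℝ (Fin m) → EuclideanSpace ℝ (Fin m) →L[ℝ] EuclideanSpace ℝ (Fin m))
    (C : EuclideanSpace ℝ (Fin m) → ℝ) (Ω : Set (EuclideanSpace ℝ (Fin m))) : Prop :=
  ∀ y ∈ Ω, ∀ v : EuclideanSpace ℝ (Fin m), ⟪∇ C y, B y v⟫_ℝ = 0

/-- `σ : [0,h] → ℝᵐ` satisfies `σ(0) = y₀` and, for all `c ∈ [0,1]`,
`σ'(ch) = ∑_{i,j<s} P_i(c) ρ_{ij}(σ) γ_j(σ) - α B̃ γ_0(σ)`.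
(Such a `σ` is a polynomial of degree at most `s` on `[0,h]`.) -/
def IsPerturbedPath
    (B : EuclideanSpace ℝ (Fin m) → EuclideanSpace ℝ (Fin m) →L[ℝ] EuclideanSpace ℝ (Fin m))
    (H : EuclideanSpace ℝ (Fin m) → ℝ)
    (Btilde : EuclideanSpace ℝ (Fin m) →L[ℝ] EuclideanSpace ℝ (Fin m))
    (s : ℕ) (y₀ : EuclideanSpace ℝ (Fin m)) (h α : ℝ)
    (σ : ℝ → EuclideanSpace ℝ (Fin m)) : Prop :=
  σ 0 = y₀ ∧ ∀ c ∈ Icc (0 : ℝ) 1,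
    HasDerivWithinAt σ
      ((∑ i ∈ Finset.range s, ∑ j ∈ Finset.range s,
          legendreP i c • rhoCoeff B i j h σ (gradCoeff H j h σ))
        - α • Btilde (gradCoeff H 0 h σ))
      (Icc 0 h) (c * h)

/-- The denominator `π_0(σ)ᵀ B̃ γ_0(σ)` in the choice of `α`. -/
noncomputable def alphaDenom (H C : EuclideanSpace ℝ (Fin m) → ℝ)
    (Btilde : EuclideanSpace ℝ (Fin m) →L[ℝ] EuclideanSpace ℝ (Fin m))
    (h : ℝ) (σ : ℝ → EuclideanSpace ℝ (Fin m)) : ℝ :=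
  ⟪gradCoeff C 0 h σ, Btilde (gradCoeff H 0 h σ)⟫_ℝ

/-- The numerator `∑_{i,j<s} π_i(σ)ᵀ ρ_{ij}(σ) γ_j(σ)` in the choice of `α`. -/
noncomputable def alphaNum
    (B : EuclideanSpace ℝ (Fin m) → EuclideanSpace ℝ (Fin m) →L[ℝ] EuclideanSpace ℝ (Fin m))
    (H C : EuclideanSpace ℝ (Fin m) → ℝ)
    (s : ℕ) (h : ℝ) (σ : ℝ → EuclideanSpace ℝ (Fin m)) : ℝ :=
  ∑ i ∈ Finset.range s, ∑ j ∈ Finset.range s,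
    ⟪gradCoeff C i h σ, rhoCoeff B i j h σ (gradCoeff H j h σ)⟫_ℝ

end PoissonHBVM

/-! Let `P` be the truncation on `[0,h]` of the Legendre expansion to degrees below `s`, and `f = B
∇H`. The method reads `σ' = P(B(σ) P ∇H(σ)) - α B̃ γ₀`, a perturbation of `y' = f(y)` with residual
`r = σ' - f(σ)`. Everything rests on one cancellation, `UTaylor.integral_bilin_of_orthogonal`: if
`g` has a Taylor expansion of order `s` uniform in `h`, then `g - Pg` is `O(h^s)` and orthogonal to
polynomials of degree below `s`, so its mean pairing with another such family is `O(h^{2s})`.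

The cancellation gives `α = O(h^{2s})`. The numerator of `α` is the mean of `⟪B P∇H, P∇C⟫`; by the
Casimir property `B P∇H` is pointwise orthogonal to `∇C`, so only its pairing with `∇C - P∇C`
remains (`uBound_integral_inner_legendreProj`), and the denominator is bounded below. It also makes
the pairing of `r` with smooth matrix families `O(h^{2s})` (`uBound_integral_residual`).

The error `e = σ - y` solves `e' = A e + r + q` with `A = f'(y)` and `q` the linearisation
remainder. Variation of constants turns `e(h)` into an integral over `[0,h]` of `r + q` against the
adjoint solution, whose length supplies the last power of `h` (`endpoint_error_of_residual`). Picard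
iterates replace the adjoint solution; their defect is a high power of `h`.

The uniform smoothness of `σ`, which depends on `h`, is bootstrapped: order `j` for `σ'` gives order
`j + 1` for functions of `σ`, and `P` preserves orders up to `s`, hence so does the right-hand side.
-/

namespace PoissonHBVM

/-! ### Legendre polynomials: orthonormality and reproduction of polynomials -/

section Legendre

open Polynomial

theorem integral_eval_derivative (p : ℝ[X]) :
    ∫ c in (0 : ℝ)..1, (derivative p).eval c = p.eval 1 - p.eval 0 :=
  intervalIntegral.integral_eq_sub_of_hasDerivAt (fun x _ => p.hasDerivAt x)
    ((derivative p).continuous.intervalIntegrable _ _)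

theorem integral_eval_mul_derivative (p q : ℝ[X]) (h0 : q.eval 0 = 0) (h1 : q.eval 1 = 0) :
    ∫ c in (0 : ℝ)..1, (p * derivative q).eval c =
      -∫ c in (0 : ℝ)..1, (derivative p * q).eval c := by
  have h := integral_eval_derivative (p * q)
  rw [derivative_mul] at h
  simp only [eval_add, eval_mul, h0, h1, mul_zero, sub_zero] at h
  rw [intervalIntegral.integral_add
    (Continuous.intervalIntegrable (by fun_prop) _ _)
    (Continuous.intervalIntegrable (by fun_prop) _ _)] at h
  simp only [eval_mul]
  linarith

/-- Repeated integration by parts. The boundary terms vanish because fewer than `n` derivatives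
leave a factor `X` and a factor `1 - X` in `X ^ n * (1 - X) ^ n`. -/
theorem integral_eval_mul_iterate_derivative (n k : ℕ) (hk : k ≤ n) (p : ℝ[X]) :
    ∫ c in (0 : ℝ)..1, (p * derivative^[k] (X ^ n * (1 - X) ^ n)).eval c =
      (-1) ^ k * ∫ c in (0 : ℝ)..1, (derivative^[k] p * (X ^ n * (1 - X) ^ n)).eval c := by
  induction k generalizing p with
  | zero => simp
  | succ k ih =>
    have h0 : (derivative^[k] (X ^ n * (1 - X) ^ n : ℝ[X])).eval 0 = 0 := by
      obtain ⟨r, hr⟩ := pow_sub_dvd_iterate_derivative_of_pow_dvd k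
        (Dvd.intro ((1 - X : ℝ[X]) ^ n) rfl : (X : ℝ[X]) ^ n ∣ X ^ n * (1 - X) ^ n)
      rw [hr]
      simp [show n - k ≠ 0 by omega]
    have h1 : (derivative^[k] (X ^ n * (1 - X) ^ n : ℝ[X])).eval 1 = 0 := by
      obtain ⟨r, hr⟩ := pow_sub_dvd_iterate_derivative_of_pow_dvd k
        (Dvd.intro_left ((X : ℝ[X]) ^ n) rfl : (1 - X : ℝ[X]) ^ n ∣ X ^ n * (1 - X) ^ n)
      rw [hr]
      simp [show n - k ≠ 0 by omega]
    rw [Function.iterate_succ_apply', integral_eval_mul_derivative _ _ h0 h1,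
      ih (by omega), Function.iterate_succ_apply, pow_succ]
    ring

/-- The beta integral, by integrating the derivative of `X ^ (a + 1) * (1 - X) ^ (b + 1)`, which
trades a power of `1 - c` for a power of `c`. It evaluates the norms of the Legendre polynomials. -/
theorem integral_pow_mul_one_sub_pow (a b : ℕ) :
    ∫ c in (0 : ℝ)..1, c ^ a * (1 - c) ^ b =
      (a.factorial * b.factorial : ℝ) / (a + b + 1).factorial := by
  induction a generalizing b with
  | zero =>
    have h := intervalIntegral.integral_comp_sub_left (a := 0) (b := 1) (fun x : ℝ => x ^ b) 1
    simp only [pow_zero, one_mul]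
    rw [h]
    simp only [sub_self, sub_zero, integral_pow, one_pow, zero_add, Nat.factorial_succ,
      Nat.factorial_zero]
    have : (b.factorial : ℝ) ≠ 0 := by positivity
    push_cast
    field_simp
    simp
  | succ a ih =>
    have h := integral_eval_derivative (X ^ (a + 1) * (1 - X) ^ (b + 1) : ℝ[X])
    have e : ∀ c : ℝ, (derivative (X ^ (a + 1) * (1 - X) ^ (b + 1) : ℝ[X])).eval c =
        (a + 1) * (c ^ a * (1 - c) ^ (b + 1)) - (b + 1) * (c ^ (a + 1) * (1 - c) ^ b) := by
      intro c
      simp [derivative_mul, derivative_pow]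
      ring
    simp only [e] at h
    rw [intervalIntegral.integral_sub (Continuous.intervalIntegrable (by fun_prop) _ _)
      (Continuous.intervalIntegrable (by fun_prop) _ _), intervalIntegral.integral_const_mul,
      intervalIntegral.integral_const_mul, ih] at h
    simp only [eval_mul, eval_pow, eval_X, eval_sub, eval_one, sub_self, sub_zero, ne_eq,
      Nat.add_eq_zero_iff, one_ne_zero, and_false, not_false_eq_true, zero_pow, mul_zero, zero_mul] at h
    have hb : (b + 1 : ℝ) ≠ 0 := by positivity
    apply mul_left_cancel₀ hb
    rw [show a + 1 + b + 1 = a + (b + 1) + 1 by omega]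
    have h3 : (b + 1 : ℝ) * ∫ c in (0 : ℝ)..1, c ^ (a + 1) * (1 - c) ^ b =
        (a + 1) * (a.factorial * (b + 1).factorial / (a + (b + 1) + 1).factorial) := by linarith
    rw [h3]
    simp only [Nat.factorial_succ a, Nat.factorial_succ b]
    push_cast
    ring

/-- The polynomial whose values are given by `legendreP`. -/
noncomputable def legendrePoly (j : ℕ) : ℝ[X] :=
  C (Real.sqrt (2 * (j : ℝ) + 1) * (-1) ^ j) * (shiftedLegendre j).map (Int.castRingHom ℝ)

theorem eval_legendrePoly (j : ℕ) (c : ℝ) : (legendrePoly j).eval c = legendreP j c := by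
  simp [legendrePoly, legendreP, aeval_def, eval₂_eq_eval_map]

theorem continuous_legendreP (j : ℕ) : Continuous (legendreP j) := by
  rw [← funext (eval_legendrePoly j)]
  exact (legendrePoly j).continuous

/-- Rodrigues' formula over the reals. -/
theorem factorial_mul_map_shiftedLegendre (n : ℕ) :
    C (n.factorial : ℝ) * (shiftedLegendre n).map (Int.castRingHom ℝ) =
      derivative^[n] (X ^ n * (1 - X) ^ n) := by
  have h := congrArg (Polynomial.map (Int.castRingHom ℝ)) (factorial_mul_shiftedLegendre_eq n)
  rw [← iterate_derivative_map] at h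
  simpa using h

theorem sqrt_two_mul_add_one_pos (j : ℕ) : 0 < Real.sqrt (2 * (j : ℝ) + 1) :=
  Real.sqrt_pos.2 (by positivity)

theorem degree_legendrePoly (j : ℕ) : (legendrePoly j).degree = j := by
  rw [legendrePoly, degree_C_mul, degree_map_eq_of_injective (RingHom.injective_int _),
    degree_shiftedLegendre]
  exact mul_ne_zero (sqrt_two_mul_add_one_pos j).ne' (by simp)

/-- Rodrigues' formula followed by `n` integrations by parts; the two signs `(-1) ^ n` cancel.
Orthogonality and normalisation both follow, since only the `n`-th derivative of `p` survives. -/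
theorem factorial_mul_integral_mul_legendrePoly (p : ℝ[X]) (n : ℕ) :
    (n.factorial : ℝ) * ∫ c in (0 : ℝ)..1, (p * legendrePoly n).eval c =
      Real.sqrt (2 * (n : ℝ) + 1) *
        ∫ c in (0 : ℝ)..1, (derivative^[n] p * (X ^ n * (1 - X) ^ n)).eval c := by
  have h := integral_eval_mul_iterate_derivative n n le_rfl p
  rw [← factorial_mul_map_shiftedLegendre] at h
  have h2 : ((-1 : ℝ) ^ n) * (-1) ^ n = 1 := by rw [← mul_pow]; simp
  have e1 : ∀ c : ℝ, (p * legendrePoly n).eval c = (Real.sqrt (2 * (n : ℝ) + 1) * (-1) ^ n) *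
      (p * (shiftedLegendre n).map (Int.castRingHom ℝ)).eval c := by
    intro c
    simp only [legendrePoly, eval_mul, eval_C]
    ring
  have e2 : ∀ c : ℝ, (p * (C (n.factorial : ℝ) *
      (shiftedLegendre n).map (Int.castRingHom ℝ))).eval c = (n.factorial : ℝ) *
      (p * (shiftedLegendre n).map (Int.castRingHom ℝ)).eval c := by
    intro c
    simp only [eval_mul, eval_C]
    ring
  simp only [e2, intervalIntegral.integral_const_mul] at h
  simp only [e1, intervalIntegral.integral_const_mul]
  linear_combination (Real.sqrt (2 * (n : ℝ) + 1) * (-1) ^ n) * h +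
    (Real.sqrt (2 * (n : ℝ) + 1) *
        ∫ c in (0 : ℝ)..1, (derivative^[n] p * (X ^ n * (1 - X) ^ n)).eval c) * h2

theorem integral_mul_legendrePoly_eq_zero (p : ℝ[X]) (n : ℕ) (hp : p.degree < n) :
    ∫ c in (0 : ℝ)..1, (p * legendrePoly n).eval c = 0 := by
  have h := factorial_mul_integral_mul_legendrePoly p n
  rw [iterate_derivative_eq_zero_of_degree_lt hp] at h
  have : (n.factorial : ℝ) ≠ 0 := by positivity
  simpa [this] using h

theorem integral_legendrePoly_mul_self (n : ℕ) :
    ∫ c in (0 : ℝ)..1, (legendrePoly n * legendrePoly n).eval c = 1 := by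
  have h := factorial_mul_integral_mul_legendrePoly (legendrePoly n) n
  -- The `n`-th derivative is the constant `n!` times the leading coefficient.
  have hd : derivative^[n] (legendrePoly n) =
      C (Real.sqrt (2 * (n : ℝ) + 1) * ((n.factorial : ℝ) * (2 * n).choose n)) := by
    rw [eq_C_of_degree_le_zero (p := derivative^[n] (legendrePoly n))]
    · congr 1
      rw [coeff_iterate_derivative]
      simp only [zero_add, Nat.descFactorial_self, legendrePoly, coeff_C_mul, coeff_map,
        coeff_shiftedLegendre, nsmul_eq_mul, Nat.choose_self, two_mul]
      have h2 : ((-1 : ℝ) ^ n) * (-1) ^ n = 1 := by rw [← mul_pow]; simp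
      simp only [eq_intCast]
      push_cast
      linear_combination (Real.sqrt (n + n + 1) * n.factorial * (n + n).choose n) * h2
    · rw [← natDegree_eq_zero_iff_degree_le_zero]
      have := natDegree_iterate_derivative (legendrePoly n) n
      rw [natDegree_eq_of_degree_eq_some (degree_legendrePoly n)] at this
      omega
  rw [hd] at h
  simp only [eval_mul, eval_C, eval_pow, eval_X, eval_sub, eval_one] at h
  rw [intervalIntegral.integral_const_mul, integral_pow_mul_one_sub_pow] at h
  simp only [eval_mul]
  have hn : (n.factorial : ℝ) ≠ 0 := by positivity
  have hs : Real.sqrt (2 * (n : ℝ) + 1) * Real.sqrt (2 * (n : ℝ) + 1) = 2 * n + 1 :=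
    Real.mul_self_sqrt (by positivity)
  have hc : ((2 * n).choose n : ℝ) * n.factorial * n.factorial = (2 * n).factorial := by
    have := Nat.choose_mul_factorial_mul_factorial (show n ≤ 2 * n by omega)
    rw [show 2 * n - n = n by omega] at this
    exact_mod_cast this
  have hf : ((n + n + 1).factorial : ℝ) = (2 * n + 1) * (2 * n).factorial := by
    rw [← two_mul, Nat.factorial_succ]; push_cast; ring
  have hf0 : ((2 * n).factorial : ℝ) ≠ 0 := by positivity
  have h21 : (2 * n + 1 : ℝ) ≠ 0 := by positivity
  apply mul_left_cancel₀ hn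
  rw [h, hf]
  field_simp
  rw [sq, hs, ← hc]
  ring

theorem integral_legendrePoly_mul (i j : ℕ) :
    ∫ c in (0 : ℝ)..1, (legendrePoly i * legendrePoly j).eval c = if i = j then 1 else 0 := by
  rcases lt_trichotomy i j with h | h | h
  · rw [if_neg h.ne, integral_mul_legendrePoly_eq_zero]
    rw [degree_legendrePoly]; exact_mod_cast h
  · subst h; rw [if_pos rfl, integral_legendrePoly_mul_self]
  · rw [if_neg h.ne', mul_comm, integral_mul_legendrePoly_eq_zero]
    rw [degree_legendrePoly]; exact_mod_cast h

/-- Both sides are linear in `p`, and the Legendre polynomials of degree below `s` span; on these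
the identity is orthonormality. -/
theorem sum_integral_mul_legendrePoly (s : ℕ) (p : ℝ[X]) (hp : p.degree < s) :
    ∑ j ∈ Finset.range s, C (∫ c in (0 : ℝ)..1, (legendrePoly j * p).eval c) * legendrePoly j
      = p := by
  let S : Polynomial.Sequence ℝ := ⟨legendrePoly, degree_legendrePoly⟩
  have hmem : p ∈ Submodule.span ℝ (S '' Set.Iio s) := by
    rw [S.span_degreeLT (fun i _ => (leadingCoeff_ne_zero.2 (S.ne_zero i)).isUnit)]
    exact mem_degreeLT.2 hp
  clear hp
  induction hmem using Submodule.span_induction with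
  | mem x hx =>
    obtain ⟨i, hi, rfl⟩ := hx
    change ∑ j ∈ Finset.range s, C (∫ c in (0 : ℝ)..1,
      (legendrePoly j * legendrePoly i).eval c) * legendrePoly j = legendrePoly i
    simp only [integral_legendrePoly_mul]
    rw [Finset.sum_eq_single i]
    · simp
    · intro j _ hj; simp [hj]
    · intro h; exact absurd (Finset.mem_range.2 hi) h
  | zero => simp
  | add x y _ _ hx hy =>
    conv_rhs => rw [← hx, ← hy]
    rw [← Finset.sum_add_distrib]
    refine Finset.sum_congr rfl fun j _ => ?_
    rw [← add_mul, ← C_add]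
    simp only [mul_add, eval_add]
    rw [intervalIntegral.integral_add (Polynomial.continuous _ |>.intervalIntegrable _ _)
      (Polynomial.continuous _ |>.intervalIntegrable _ _)]
  | smul a x _ hx =>
    conv_rhs => rw [← hx]
    rw [Finset.smul_sum]
    refine Finset.sum_congr rfl fun j _ => ?_
    simp only [mul_smul_comm, eval_smul, smul_eq_mul, intervalIntegral.integral_const_mul]
    rw [C_mul, mul_assoc, ← smul_eq_C_mul]

/-- The first `s` Legendre polynomials reproduce the monomials of degree less than `s`. -/
theorem sum_integral_legendreP_mul_pow {s i : ℕ} (hi : i < s) (x : ℝ) :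
    ∑ j ∈ Finset.range s, (∫ c in (0 : ℝ)..1, legendreP j c * c ^ i) * legendreP j x = x ^ i := by
  have h := congrArg (Polynomial.eval x) (sum_integral_mul_legendrePoly s (X ^ i)
    (by rw [degree_X_pow]; exact_mod_cast hi))
  rw [eval_finsetSum] at h
  simpa [eval_legendrePoly] using h

end Legendre

/-! ### Families on `[0,h]` with bounds and Taylor expansions uniform in `h` -/

section Classes

set_option linter.unusedSectionVars false

universe u

variable {E F G : Type*} [NormedAddCommGroup E] [NormedSpace ℝ E] [NormedAddCommGroup F]
  [NormedSpace ℝ F] [NormedAddCommGroup G] [NormedSpace ℝ G]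

/-- The family `g h : [0,h] → E` is `O(h^k)` as `h → 0⁺`, uniformly on `[0,h]`. -/
def UBound (k : ℕ) (g : ℝ → ℝ → E) : Prop :=
  ∃ M : ℝ, 0 ≤ M ∧ ∀ᶠ h in 𝓝[>] (0 : ℝ), ∀ t ∈ Icc 0 h, ‖g h t‖ ≤ M * h ^ k

/-- The members of the family are continuous on `[0,h]` for small `h`. -/
def UCont (g : ℝ → ℝ → E) : Prop :=
  ∀ᶠ h in 𝓝[>] (0 : ℝ), ContinuousOn (g h) (Icc 0 h)

/-- The family `g h : [0,h] → E` has a Taylor expansion of order `k` with uniformly bounded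
coefficients and a uniform remainder `O(h^k)`. -/
def UTaylor (k : ℕ) (g : ℝ → ℝ → E) : Prop :=
  ∃ a : ℕ → ℝ → E, (∀ i, UBound 0 (fun h _ => a i h)) ∧
    UBound k (fun h t => g h t - ∑ i ∈ Finset.range k, t ^ i • a i h)

theorem eventually_pos : ∀ᶠ h in 𝓝[>] (0 : ℝ), 0 < h := self_mem_nhdsWithin

theorem eventually_lt {r : ℝ} (hr : 0 < r) : ∀ᶠ h in 𝓝[>] (0 : ℝ), h < r :=
  mem_of_superset (Ioo_mem_nhdsGT hr) fun _ h => h.2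

theorem UBound.congr {k : ℕ} {g g' : ℝ → ℝ → E} (hg : UBound k g)
    (h : ∀ᶠ h in 𝓝[>] (0 : ℝ), ∀ t ∈ Icc 0 h, g' h t = g h t) : UBound k g' := by
  obtain ⟨M, hM, hg⟩ := hg
  refine ⟨M, hM, ?_⟩
  filter_upwards [hg, h] with h h1 h2 t ht
  rw [h2 t ht]
  exact h1 t ht

theorem UBound.mono {k l : ℕ} (hkl : l ≤ k) {g : ℝ → ℝ → E} (hg : UBound k g) : UBound l g := by
  obtain ⟨M, hM, hg⟩ := hg
  refine ⟨M, hM, ?_⟩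
  filter_upwards [hg, eventually_pos, eventually_lt one_pos] with h h1 h0 h2 t ht
  refine (h1 t ht).trans (mul_le_mul_of_nonneg_left ?_ hM)
  exact pow_le_pow_of_le_one h0.le h2.le hkl

theorem UBound.zero (k : ℕ) : UBound k (fun _ _ => (0 : E)) :=
  ⟨0, le_rfl, Eventually.of_forall fun h t _ => by simp⟩

theorem UBound.const (v : E) : UBound 0 (fun _ _ => v) :=
  ⟨‖v‖, norm_nonneg _, Eventually.of_forall fun h t _ => by simp⟩

theorem UBound.add {k : ℕ} {g f : ℝ → ℝ → E} (hg : UBound k g) (hf : UBound k f) :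
    UBound k (fun h t => g h t + f h t) := by
  obtain ⟨M, hM, hg⟩ := hg
  obtain ⟨N, hN, hf⟩ := hf
  refine ⟨M + N, by positivity, ?_⟩
  filter_upwards [hg, hf] with h h1 h2 t ht
  rw [add_mul]
  exact norm_add_le_of_le (h1 t ht) (h2 t ht)

theorem UBound.neg {k : ℕ} {g : ℝ → ℝ → E} (hg : UBound k g) :
    UBound k (fun h t => -g h t) := by
  simpa [UBound] using hg

theorem UBound.sub {k : ℕ} {g f : ℝ → ℝ → E} (hg : UBound k g) (hf : UBound k f) :
    UBound k (fun h t => g h t - f h t) := by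
  simpa only [sub_eq_add_neg] using hg.add hf.neg

theorem UBound.sum {ι : Type*} {k : ℕ} (S : Finset ι) {g : ι → ℝ → ℝ → E}
    (hg : ∀ i ∈ S, UBound k (g i)) : UBound k (fun h t => ∑ i ∈ S, g i h t) := by
  classical
  induction S using Finset.induction_on with
  | empty => simpa using UBound.zero k
  | insert i S hi ih =>
    simp only [Finset.sum_insert hi]
    exact (hg i (by simp)).add (ih fun j hj => hg j (by simp [hj]))

theorem UBound.bilin (L : E →L[ℝ] F →L[ℝ] G) {k l : ℕ} {g : ℝ → ℝ → E} {f : ℝ → ℝ → F}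
    (hg : UBound k g) (hf : UBound l f) : UBound (k + l) (fun h t => L (g h t) (f h t)) := by
  obtain ⟨M, hM, hg⟩ := hg
  obtain ⟨N, hN, hf⟩ := hf
  refine ⟨‖L‖ * M * N, by positivity, ?_⟩
  filter_upwards [hg, hf, eventually_pos] with h h1 h2 h0 t ht
  calc ‖L (g h t) (f h t)‖ ≤ ‖L‖ * ‖g h t‖ * ‖f h t‖ := L.le_opNorm₂ _ _
    _ ≤ ‖L‖ * (M * h ^ k) * (N * h ^ l) := by
        gcongr
        · exact h1 t ht
        · exact h2 t ht
    _ = ‖L‖ * M * N * h ^ (k + l) := by ring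

theorem UBound.smul {k l : ℕ} {g : ℝ → ℝ → ℝ} {f : ℝ → ℝ → F}
    (hg : UBound k g) (hf : UBound l f) : UBound (k + l) (fun h t => g h t • f h t) :=
  hg.bilin (ContinuousLinearMap.lsmul ℝ ℝ) hf

theorem UBound.pow (k : ℕ) : UBound k (fun _ t => t ^ k) := by
  refine ⟨1, zero_le_one, Eventually.of_forall fun h t ht => ?_⟩
  rw [norm_pow, Real.norm_of_nonneg ht.1, one_mul]
  exact pow_le_pow_left₀ ht.1 ht.2 k

theorem UBound.at_endpoint {k : ℕ} {g : ℝ → ℝ → E} (hg : UBound k g) :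
    UBound k (fun h _ => g h 0) := by
  obtain ⟨M, hM, hg⟩ := hg
  refine ⟨M, hM, ?_⟩
  filter_upwards [hg, eventually_pos] with h h1 h0 t _
  exact h1 0 ⟨le_rfl, h0.le⟩

theorem mul_mem_Icc {h c : ℝ} (h0 : 0 < h) (hc : c ∈ Icc (0 : ℝ) 1) : c * h ∈ Icc 0 h :=
  ⟨mul_nonneg hc.1 h0.le, mul_le_of_le_one_left h0.le hc.2⟩

theorem UBound.integral {k : ℕ} {g : ℝ → ℝ → E} (hg : UBound k g) :
    UBound k (fun h _ => ∫ c in (0 : ℝ)..1, g h (c * h)) := by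
  obtain ⟨M, hM, hg⟩ := hg
  refine ⟨M, hM, ?_⟩
  filter_upwards [hg, eventually_pos] with h h1 h0 t _
  have := intervalIntegral.norm_integral_le_of_norm_le_const (a := (0 : ℝ)) (b := 1)
    (f := fun c => g h (c * h)) (C := M * h ^ k) fun c hc => by
      rw [uIoc_of_le zero_le_one] at hc
      exact h1 _ (mul_mem_Icc h0 ⟨hc.1.le, hc.2⟩)
  simpa using this

/-- A continuous function of the rescaled variable `t / h` is a bounded family. -/
theorem UBound.rescaled {q : ℝ → ℝ} (hq : Continuous q) : UBound 0 (fun h t => q (t / h)) := by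
  obtain ⟨M, hM⟩ := isCompact_Icc.exists_bound_of_continuousOn (s := Icc (0 : ℝ) 1)
    hq.continuousOn
  refine ⟨M, (norm_nonneg _).trans (hM 0 (by simp)), ?_⟩
  filter_upwards [eventually_pos] with h h0 t ht
  rw [pow_zero, mul_one]
  exact hM _ ⟨div_nonneg ht.1 h0.le, (div_le_one h0).2 ht.2⟩

theorem UBound.integral_smul {k : ℕ} {q : ℝ → ℝ} (hq : Continuous q) {g : ℝ → ℝ → E}
    (hg : UBound k g) : UBound k (fun h _ => ∫ c in (0 : ℝ)..1, q c • g h (c * h)) := by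
  have h1 := ((UBound.rescaled hq).smul hg).integral
  rw [zero_add] at h1
  refine h1.congr ?_
  filter_upwards [eventually_pos] with h h0 t _
  simp only [mul_div_cancel_right₀ _ h0.ne']

theorem UTaylor.of_bound {k : ℕ} {g : ℝ → ℝ → E} (hg : UBound k g) : UTaylor k g :=
  ⟨fun _ _ => 0, fun _ => UBound.zero 0, by simpa using hg⟩

theorem UTaylor.congr {k : ℕ} {g g' : ℝ → ℝ → E} (hg : UTaylor k g)
    (h : ∀ᶠ h in 𝓝[>] (0 : ℝ), ∀ t ∈ Icc 0 h, g' h t = g h t) : UTaylor k g' := by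
  obtain ⟨a, ha, hg⟩ := hg
  refine ⟨a, ha, hg.congr ?_⟩
  filter_upwards [h] with h h1 t ht
  rw [h1 t ht]

theorem UTaylor.add {k : ℕ} {g f : ℝ → ℝ → E} (hg : UTaylor k g) (hf : UTaylor k f) :
    UTaylor k (fun h t => g h t + f h t) := by
  obtain ⟨a, ha, hg⟩ := hg
  obtain ⟨b, hb, hf⟩ := hf
  refine ⟨fun i h => a i h + b i h, fun i => (ha i).add (hb i), (hg.add hf).congr ?_⟩
  refine Eventually.of_forall fun h t _ => ?_
  simp only [smul_add, Finset.sum_add_distrib]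
  abel

theorem UTaylor.neg {k : ℕ} {g : ℝ → ℝ → E} (hg : UTaylor k g) :
    UTaylor k (fun h t => -g h t) := by
  obtain ⟨a, ha, hg⟩ := hg
  refine ⟨fun i h => -a i h, fun i => (ha i).neg, hg.neg.congr ?_⟩
  refine Eventually.of_forall fun h t _ => ?_
  simp only [smul_neg, Finset.sum_neg_distrib]
  abel

theorem UTaylor.sub {k : ℕ} {g f : ℝ → ℝ → E} (hg : UTaylor k g) (hf : UTaylor k f) :
    UTaylor k (fun h t => g h t - f h t) := by
  simpa only [sub_eq_add_neg] using hg.add hf.neg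

theorem UTaylor.sum {ι : Type*} {k : ℕ} (S : Finset ι) {g : ι → ℝ → ℝ → E}
    (hg : ∀ i ∈ S, UTaylor k (g i)) : UTaylor k (fun h t => ∑ i ∈ S, g i h t) := by
  classical
  induction S using Finset.induction_on with
  | empty => simpa using UTaylor.of_bound (UBound.zero k)
  | insert i S hi ih =>
    simp only [Finset.sum_insert hi]
    exact (hg i (by simp)).add (ih fun j hj => hg j (by simp [hj]))

/-- For `i ≥ k` the monomial itself is `O(h^k)` on `[0,h]` and joins the remainder. This lets
`UTaylor.bilin` multiply expansions without truncating the product. -/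
theorem UTaylor.monomial (k i : ℕ) {b : ℝ → E} (hb : UBound 0 (fun h _ => b h)) :
    UTaylor k (fun h t => t ^ i • b h) := by
  rcases lt_or_ge i k with hi | hi
  · refine ⟨fun j h => if j = i then b h else 0, fun j => ?_, (UBound.zero k).congr ?_⟩
    · by_cases hj : j = i
      · simpa [hj] using hb
      · simpa [hj] using UBound.zero 0
    · refine Eventually.of_forall fun h t _ => ?_
      simp [smul_ite, Finset.sum_ite_eq', hi]
  · exact UTaylor.of_bound (((UBound.pow i).smul hb).mono hi)

theorem UTaylor.const (k : ℕ) {b : ℝ → E} (hb : UBound 0 (fun h _ => b h)) :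
    UTaylor k (fun h _ => b h) := by
  simpa using UTaylor.monomial k 0 hb

theorem UBound.polynomial {a : ℕ → ℝ → E} (ha : ∀ i, UBound 0 (fun h _ => a i h)) (k : ℕ) :
    UBound 0 (fun h t => ∑ i ∈ Finset.range k, t ^ i • a i h) :=
  UBound.sum _ fun i _ => ((UBound.pow i).smul (ha i)).mono (Nat.zero_le _)

theorem UTaylor.bounded {k : ℕ} {g : ℝ → ℝ → E} (hg : UTaylor k g) : UBound 0 g := by
  obtain ⟨a, ha, hg⟩ := hg
  refine ((hg.mono (Nat.zero_le k)).add (UBound.polynomial ha k)).congr ?_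
  exact Eventually.of_forall fun h t _ => by simp

theorem UTaylor.mono {k l : ℕ} (hkl : l ≤ k) {g : ℝ → ℝ → E} (hg : UTaylor k g) :
    UTaylor l g := by
  obtain ⟨a, ha, hg⟩ := hg
  refine ((UTaylor.of_bound (hg.mono hkl)).add (UTaylor.sum (Finset.range k) fun i _ =>
    UTaylor.monomial l i (ha i))).congr ?_
  exact Eventually.of_forall fun h t _ => by simp

theorem UTaylor.bilin (L : E →L[ℝ] F →L[ℝ] G) {k : ℕ} {g : ℝ → ℝ → E} {f : ℝ → ℝ → F}
    (hg : UTaylor k g) (hf : UTaylor k f) : UTaylor k (fun h t => L (g h t) (f h t)) := by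
  have hg0 := hg.bounded
  obtain ⟨a, ha, hg⟩ := hg
  obtain ⟨b, hb, hf⟩ := hf
  have h1 := hg.bilin L (UBound.polynomial hb k)
  have h2 := hg0.bilin L hf
  rw [zero_add] at h2
  refine ((UTaylor.of_bound (h1.add h2)).add (UTaylor.sum (Finset.range k) fun i _ =>
    UTaylor.sum (Finset.range k) fun j _ =>
      UTaylor.monomial k (i + j) ((ha i).bilin L (hb j)))).congr ?_
  refine Eventually.of_forall fun h t _ => ?_
  have e : ∑ i ∈ Finset.range k, ∑ j ∈ Finset.range k, t ^ (i + j) • L (a i h) (b j h) =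
      L (∑ i ∈ Finset.range k, t ^ i • a i h) (∑ j ∈ Finset.range k, t ^ j • b j h) := by
    simp only [map_sum, sum_apply, map_smul, smul_apply, Finset.smul_sum, smul_smul, pow_add]
    rw [Finset.sum_comm]
    simp only [mul_comm]
  rw [e]
  simp only [map_sub, sub_apply]
  abel

/-- Integrating the expansion shifts its coefficients by one place; the mean value inequality gives
the remainder an extra factor `h`. -/
theorem UTaylor.antideriv {k : ℕ} {f g : ℝ → ℝ → E}
    (hfg : ∀ᶠ h in 𝓝[>] (0 : ℝ), ∀ t ∈ Icc 0 h, HasDerivWithinAt (f h) (g h t) (Icc 0 h) t)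
    (h0 : UBound 0 (fun h _ => f h 0)) (hg : UTaylor k g) : UTaylor (k + 1) f := by
  obtain ⟨a, ha, M, hM, hg⟩ := hg
  refine ⟨fun i h => Nat.casesOn i (f h 0) fun i => ((i : ℝ) + 1)⁻¹ • a i h, fun i => ?_,
    M, hM, ?_⟩
  · cases i with
    | zero => exact h0
    | succ i =>
      exact (UBound.const ((i : ℝ) + 1)⁻¹).smul (ha i)
  · filter_upwards [hfg, hg, eventually_pos] with h h1 h2 hpos t ht
    rw [Finset.sum_range_succ']
    simp only [pow_zero, one_smul]
    have hd : ∀ x ∈ Icc 0 h, HasDerivWithinAt (fun t => f h t -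
        ∑ i ∈ Finset.range k, t ^ (i + 1) • ((i : ℝ) + 1)⁻¹ • a i h)
        (g h x - ∑ i ∈ Finset.range k, x ^ i • a i h) (Icc 0 h) x := by
      intro x hx
      refine (h1 x hx).sub (HasDerivWithinAt.fun_sum fun i _ => ?_)
      have := ((hasDerivAt_pow (i + 1) x).smul_const
        (((i : ℝ) + 1)⁻¹ • a i h)).hasDerivWithinAt (s := Icc 0 h)
      convert this using 1
      have hi : (i + 1 : ℝ) ≠ 0 := by positivity
      rw [smul_smul]
      congr 1
      push_cast
      field_simp
    have hb := norm_image_sub_le_of_norm_deriv_le_segment' hd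
      (fun x hx => h2 x (Ico_subset_Icc_self hx)) t ht
    simp only [sub_zero, ne_eq, Nat.add_eq_zero_iff, one_ne_zero, and_false, not_false_eq_true,
      zero_pow, zero_smul, Finset.sum_const_zero] at hb
    rw [sub_sub] at hb
    refine hb.trans ?_
    rw [pow_succ, ← mul_assoc]
    have := hpos.le
    exact mul_le_mul_of_nonneg_left ht.2 (by positivity)

/-- By the chain rule the derivative of `f ∘ x` is `f'(x) x'`, so the induction applies to `fderiv ℝ
f` and then integrates. Only orders below `k` of `x'` enter, which is what makes bootstrapping
possible. The common universe lets the induction replace `F` by `E →L[ℝ] F`. -/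
theorem UTaylor.comp {E F : Type u} [NormedAddCommGroup E] [NormedSpace ℝ E]
    [NormedAddCommGroup F] [NormedSpace ℝ F] {Ω K : Set E} (hΩ : IsOpen Ω) (hK : IsCompact K)
    (hKΩ : K ⊆ Ω) {x x' : ℝ → ℝ → E} (hxK : ∀ᶠ h in 𝓝[>] (0 : ℝ), ∀ t ∈ Icc 0 h, x h t ∈ K)
    (hx : ∀ᶠ h in 𝓝[>] (0 : ℝ), ∀ t ∈ Icc 0 h, HasDerivWithinAt (x h) (x' h t) (Icc 0 h) t)
    {k : ℕ} {f : E → F} (hf : ContDiffOn ℝ k f Ω) (hx' : ∀ j < k, UTaylor j x') :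
    UTaylor k (fun h t => f (x h t)) := by
  induction k generalizing F with
  | zero =>
    obtain ⟨M, hM⟩ := hK.exists_bound_of_continuousOn (hf.continuousOn.mono hKΩ)
    refine UTaylor.of_bound ⟨max M 0, le_max_right _ _, ?_⟩
    filter_upwards [hxK] with h h1 t ht
    rw [pow_zero, mul_one]
    exact (hM _ (h1 t ht)).trans (le_max_left _ _)
  | succ k ih =>
    have h0 : UBound 0 (fun h t => f (x h t)) :=
      (ih (hf.of_le (by exact_mod_cast Nat.le_succ k))
        fun j hj => hx' j (by omega)).bounded
    have h1 := ih (f := fderiv ℝ f) (hf.fderiv_of_isOpen hΩ (by norm_cast))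
      fun j hj => hx' j (by omega)
    refine UTaylor.antideriv (g := fun h t => fderiv ℝ f (x h t) (x' h t)) ?_ h0.at_endpoint
      (h1.bilin (ContinuousLinearMap.id ℝ (E →L[ℝ] F)) (hx' k (by omega)))
    filter_upwards [hxK, hx] with h hK hd t ht
    have hdf : DifferentiableAt ℝ f (x h t) :=
      (hf.differentiableOn (by norm_cast)).differentiableAt (hΩ.mem_nhds (hKΩ (hK t ht)))
    exact hdf.hasFDerivAt.comp_hasDerivWithinAt t (hd t ht)

theorem UCont.of_hasDeriv {f g : ℝ → ℝ → E}
    (hfg : ∀ᶠ h in 𝓝[>] (0 : ℝ), ∀ t ∈ Icc 0 h, HasDerivWithinAt (f h) (g h t) (Icc 0 h) t) :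
    UCont f := by
  filter_upwards [hfg] with h h1 t ht
  exact (h1 t ht).continuousWithinAt

theorem UCont.comp {Ω : Set E} {x : ℝ → ℝ → E} {f : E → F} (hx : UCont x)
    (hxΩ : ∀ᶠ h in 𝓝[>] (0 : ℝ), ∀ t ∈ Icc 0 h, x h t ∈ Ω) (hf : ContinuousOn f Ω) :
    UCont (fun h t => f (x h t)) := by
  filter_upwards [hx, hxΩ] with h h1 h2
  exact hf.comp h1 h2

theorem UCont.sub {g f : ℝ → ℝ → E} (hg : UCont g) (hf : UCont f) :
    UCont (fun h t => g h t - f h t) := by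
  filter_upwards [hg, hf] with h h1 h2
  exact h1.sub h2

theorem UCont.bilin (L : E →L[ℝ] F →L[ℝ] G) {g : ℝ → ℝ → E} {f : ℝ → ℝ → F}
    (hg : UCont g) (hf : UCont f) : UCont (fun h t => L (g h t) (f h t)) := by
  filter_upwards [hg, hf] with h h1 h2
  exact (L.continuous.comp_continuousOn h1).clm_apply h2

theorem intervalIntegrable_rescaled {h : ℝ} (h0 : 0 < h) {g : ℝ → E}
    (hg : ContinuousOn g (Icc 0 h)) :
    IntervalIntegrable (fun c => g (c * h)) MeasureTheory.volume 0 1 := by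
  refine ContinuousOn.intervalIntegrable ?_
  rw [uIcc_of_le zero_le_one]
  exact hg.comp (by fun_prop) fun c hc => mul_mem_Icc h0 hc

theorem intervalIntegrable_smul_rescaled {h : ℝ} (h0 : 0 < h) {q : ℝ → ℝ} (hq : Continuous q)
    {g : ℝ → E} (hg : ContinuousOn g (Icc 0 h)) :
    IntervalIntegrable (fun c => q c • g (c * h)) MeasureTheory.volume 0 1 :=
  (intervalIntegrable_rescaled h0 hg).continuousOn_smul hq.continuousOn

end Classes

/-! ### Truncated Legendre expansions on `[0,h]` -/

section Projection

set_option linter.unusedSectionVars false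

variable {E F G : Type*} [NormedAddCommGroup E] [NormedSpace ℝ E] [NormedAddCommGroup F]
  [NormedSpace ℝ F] [NormedAddCommGroup G] [NormedSpace ℝ G]

/-- The `j`-th Legendre coefficient of the rescaled path `c ↦ g h (c h)`. -/
noncomputable def legendreCoeff (j : ℕ) (g : ℝ → ℝ → E) (h : ℝ) : E :=
  ∫ c in (0 : ℝ)..1, legendreP j c • g h (c * h)

/-- The truncation of the Legendre expansion on `[0,h]` to polynomials of degree less than `s`. -/
noncomputable def legendreProj (s : ℕ) (g : ℝ → ℝ → E) (h t : ℝ) : E :=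
  ∑ j ∈ Finset.range s, legendreP j (t / h) • legendreCoeff j g h

theorem legendreProj_rescaled (s : ℕ) (g : ℝ → ℝ → E) {h : ℝ} (h0 : 0 < h) (c : ℝ) :
    legendreProj s g h (c * h) = ∑ j ∈ Finset.range s, legendreP j c • legendreCoeff j g h := by
  simp only [legendreProj, mul_div_cancel_right₀ _ h0.ne']

theorem UBound.legendreCoeff {k : ℕ} {g : ℝ → ℝ → E} (hg : UBound k g) (j : ℕ) :
    UBound k (fun h _ => legendreCoeff j g h) :=
  hg.integral_smul (continuous_legendreP j)

/-- After rescaling to `[0,1]` the projection no longer depends on `h`, so it is bounded uniformly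
in `h`. -/
theorem UBound.legendreProj {k : ℕ} {g : ℝ → ℝ → E} (hg : UBound k g) (s : ℕ) :
    UBound k (legendreProj s g) := by
  refine UBound.sum _ fun j _ => ?_
  have := (UBound.rescaled (continuous_legendreP j)).smul (hg.legendreCoeff j)
  rwa [zero_add] at this

theorem continuous_legendreProj (s : ℕ) (g : ℝ → ℝ → E) (h : ℝ) :
    Continuous (legendreProj s g h) :=
  continuous_finsetSum _ fun j _ =>
    ((continuous_legendreP j).comp (continuous_id.div_const h)).smul continuous_const

theorem UCont.legendreProj (s : ℕ) (g : ℝ → ℝ → E) : UCont (legendreProj s g) :=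
  Eventually.of_forall fun h => (continuous_legendreProj s g h).continuousOn

theorem legendreProj_sub (s : ℕ) {g f : ℝ → ℝ → E} {h : ℝ} (h0 : 0 < h)
    (hg : ContinuousOn (g h) (Icc 0 h)) (hf : ContinuousOn (f h) (Icc 0 h)) (t : ℝ) :
    legendreProj s (fun h t => g h t - f h t) h t = legendreProj s g h t - legendreProj s f h t := by
  simp only [legendreProj, ← Finset.sum_sub_distrib, ← smul_sub]
  refine Finset.sum_congr rfl fun j _ => ?_
  congr 1
  simp only [legendreCoeff, smul_sub]
  exact intervalIntegral.integral_sub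
    (intervalIntegrable_smul_rescaled h0 (continuous_legendreP j) hg)
    (intervalIntegrable_smul_rescaled h0 (continuous_legendreP j) hf)

theorem legendreProj_polynomial [CompleteSpace E] {s k : ℕ} (hk : k ≤ s) (a : ℕ → ℝ → E) {h : ℝ}
    (h0 : 0 < h) (t : ℝ) :
    legendreProj s (fun h t => ∑ i ∈ Finset.range k, t ^ i • a i h) h t =
      ∑ i ∈ Finset.range k, t ^ i • a i h := by
  have e : ∀ j, legendreCoeff j (fun h t => ∑ i ∈ Finset.range k, t ^ i • a i h) h =
      ∑ i ∈ Finset.range k, (∫ c in (0 : ℝ)..1, legendreP j c * c ^ i) • (h ^ i • a i h) := by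
    intro j
    have hc := continuous_legendreP j
    simp only [legendreCoeff, Finset.smul_sum]
    rw [intervalIntegral.integral_finsetSum
      fun i _ => Continuous.intervalIntegrable (by fun_prop) _ _]
    refine Finset.sum_congr rfl fun i _ => ?_
    rw [← intervalIntegral.integral_smul_const]
    congr 1
    ext c
    rw [smul_smul, smul_smul, mul_pow, mul_assoc]
  simp only [legendreProj, e, Finset.smul_sum]
  rw [Finset.sum_comm]
  refine Finset.sum_congr rfl fun i hi => ?_
  have hi' := sum_integral_legendreP_mul_pow
    (lt_of_lt_of_le (Finset.mem_range.1 hi) hk) (t / h)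
  simp only [smul_smul, ← Finset.sum_smul]
  congr 1
  simp only [← mul_assoc, ← Finset.sum_mul]
  simp only [mul_comm (legendreP _ (t / h))]
  rw [hi', div_pow, div_mul_cancel₀ _ (pow_ne_zero _ h0.ne')]

/-- The projection fixes the Taylor polynomial, of degree below `k ≤ s`, so only the remainder and
its projection are left. -/
theorem UTaylor.sub_legendreProj [CompleteSpace E] {s k : ℕ} (hk : k ≤ s) {g : ℝ → ℝ → E}
    (hg : UTaylor k g) (hc : UCont g) : UBound k (fun h t => g h t - legendreProj s g h t) := by
  obtain ⟨a, ha, hg⟩ := hg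
  refine (hg.sub (hg.legendreProj s)).congr ?_
  filter_upwards [hc, eventually_pos] with h h1 h0 t _
  rw [legendreProj_sub s h0 h1 (by fun_prop), legendreProj_polynomial hk a h0]
  abel

theorem UTaylor.legendreProj [CompleteSpace E] {s k : ℕ} (hk : k ≤ s) {g : ℝ → ℝ → E}
    (hg : UTaylor k g) (hc : UCont g) : UTaylor k (legendreProj s g) := by
  refine (hg.sub (UTaylor.of_bound (hg.sub_legendreProj hk hc))).congr ?_
  exact Eventually.of_forall fun h t _ => by abel

theorem integral_pow_smul_sub_legendreProj [CompleteSpace E] {s i : ℕ} (hi : i < s)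
    {g : ℝ → ℝ → E} {h : ℝ} (h0 : 0 < h) (hg : ContinuousOn (g h) (Icc 0 h)) :
    ∫ c in (0 : ℝ)..1, c ^ i • (g h (c * h) - legendreProj s g h (c * h)) = 0 := by
  have hP := continuous_legendreP
  simp only [smul_sub, legendreProj_rescaled s g h0]
  rw [intervalIntegral.integral_sub (intervalIntegrable_smul_rescaled h0 (by fun_prop) hg)
    (Continuous.intervalIntegrable (by fun_prop) _ _), sub_eq_zero]
  simp only [Finset.smul_sum, smul_smul]
  rw [intervalIntegral.integral_finsetSum
      fun j _ => Continuous.intervalIntegrable (by fun_prop) _ _]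
  have e : ∀ j, ∫ c in (0 : ℝ)..1, (c ^ i * legendreP j c) • legendreCoeff j g h =
      ∫ c in (0 : ℝ)..1, (∫ x in (0 : ℝ)..1, legendreP j x * x ^ i) • legendreP j c •
        g h (c * h) := by
    intro j
    rw [intervalIntegral.integral_smul_const, intervalIntegral.integral_smul]
    simp only [mul_comm, legendreCoeff]
  simp only [e]
  rw [← intervalIntegral.integral_finsetSum]
  · congr 1
    ext c
    simp only [smul_smul, ← Finset.sum_smul, sum_integral_legendreP_mul_pow hi c]
  · intro j _
    exact (intervalIntegrable_smul_rescaled h0 (hP j) hg).smul _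

theorem integral_bilin_legendreProj [CompleteSpace E] [CompleteSpace G]
    (L : E →L[ℝ] F →L[ℝ] G) (s : ℕ) {g : ℝ → ℝ → E} (f : ℝ → ℝ → F) {h : ℝ} (h0 : 0 < h)
    (hg : ContinuousOn (g h) (Icc 0 h)) :
    ∫ c in (0 : ℝ)..1, L (g h (c * h)) (legendreProj s f h (c * h)) =
      ∑ j ∈ Finset.range s, L (legendreCoeff j g h) (legendreCoeff j f h) := by
  simp only [legendreProj_rescaled s f h0, map_sum, map_smul]
  have e : ∀ j (v : F) (c : ℝ), legendreP j c • L (g h (c * h)) v =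
      L.flip v (legendreP j c • g h (c * h)) := fun j v c => by simp
  have hint := fun j => intervalIntegrable_smul_rescaled h0 (continuous_legendreP j) hg
  simp only [e]
  rw [intervalIntegral.integral_finsetSum]
  · refine Finset.sum_congr rfl fun j _ => ?_
    rw [ContinuousLinearMap.intervalIntegral_comp_comm _ (hint j)]
    rfl
  · intro j _
    exact ⟨(L.flip _).integrable_comp (hint j).1, (L.flip _).integrable_comp (hint j).2⟩

/-- The projection is self-adjoint for every bilinear pairing: both sides equal the sum of the
pairings of the first `s` coefficients. -/
theorem integral_bilin_legendreProj_comm [CompleteSpace E] [CompleteSpace F] [CompleteSpace G]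
    (L : E →L[ℝ] F →L[ℝ] G) (s : ℕ) {g : ℝ → ℝ → E} {f : ℝ → ℝ → F} {h : ℝ} (h0 : 0 < h)
    (hg : ContinuousOn (g h) (Icc 0 h)) (hf : ContinuousOn (f h) (Icc 0 h)) :
    ∫ c in (0 : ℝ)..1, L (g h (c * h)) (legendreProj s f h (c * h)) =
      ∫ c in (0 : ℝ)..1, L (legendreProj s g h (c * h)) (f h (c * h)) := by
  rw [integral_bilin_legendreProj L s f h0 hg]
  exact (integral_bilin_legendreProj L.flip s g h0 hf).symm

/-- Pairing a family that is smooth to order `s` with a family of size `O(h^s)` orthogonal to the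
polynomials of degree less than `s` gains a factor `h^s`. -/
theorem UTaylor.integral_bilin_of_orthogonal [CompleteSpace F] [CompleteSpace G]
    (L : E →L[ℝ] F →L[ℝ] G)
    {s : ℕ} {g : ℝ → ℝ → E} {R : ℝ → ℝ → F} (hg : UTaylor s g) (hgc : UCont g) (hR : UBound s R)
    (hRc : UCont R)
    (horth : ∀ᶠ h in 𝓝[>] (0 : ℝ), ∀ i < s, ∫ c in (0 : ℝ)..1, c ^ i • R h (c * h) = 0) :
    UBound (2 * s) (fun h _ => ∫ c in (0 : ℝ)..1, L (g h (c * h)) (R h (c * h))) := by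
  obtain ⟨a, ha, hg⟩ := hg
  -- The Taylor polynomial of `g` pairs to zero with `R`, so `g` may be replaced by its `O(h^s)`
  -- remainder.
  rw [two_mul]
  refine (hg.bilin L hR).integral.congr ?_
  filter_upwards [hgc, hRc, horth, eventually_pos] with h h1 h2 h3 h0 t _
  have hi1 : IntervalIntegrable (fun c => L (g h (c * h)) (R h (c * h)))
      MeasureTheory.volume 0 1 :=
    intervalIntegrable_rescaled h0 (g := fun t => L (g h t) (R h t))
      ((L.continuous.comp_continuousOn h1).clm_apply h2)
  have hi2 : ∀ i ∈ Finset.range s, IntervalIntegrable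
      (fun c => L (a i h) ((c * h) ^ i • R h (c * h))) MeasureTheory.volume 0 1 := fun i _ =>
    intervalIntegrable_rescaled h0 (g := fun t => L (a i h) (t ^ i • R h t))
      ((L _).continuous.comp_continuousOn (ContinuousOn.smul (by fun_prop) h2))
  have e : ∀ c, L (g h (c * h) - ∑ i ∈ Finset.range s, (c * h) ^ i • a i h) (R h (c * h)) =
      L (g h (c * h)) (R h (c * h)) -
        ∑ i ∈ Finset.range s, L (a i h) ((c * h) ^ i • R h (c * h)) := by
    intro c
    simp only [map_sub, map_sum, map_smul, sub_apply, sum_apply, smul_apply]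
  simp only [e]
  have hsum : ∑ i ∈ Finset.range s, ∫ c in (0 : ℝ)..1, L (a i h) ((c * h) ^ i • R h (c * h))
      = 0 := by
    refine Finset.sum_eq_zero fun i hi => ?_
    rw [ContinuousLinearMap.intervalIntegral_comp_comm]
    · have e2 : ∀ c, (c * h) ^ i • R h (c * h) = h ^ i • c ^ i • R h (c * h) := fun c => by
        rw [smul_smul, mul_pow, mul_comm]
      simp only [e2, intervalIntegral.integral_smul, h3 i (Finset.mem_range.1 hi), smul_zero,
        map_zero]
    · exact intervalIntegrable_rescaled h0 (g := fun t => t ^ i • R h t)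
        (ContinuousOn.smul (by fun_prop) h2)
  rw [intervalIntegral.integral_sub hi1, intervalIntegral.integral_finsetSum hi2, hsum, sub_zero]
  have := IntervalIntegrable.sum _ hi2
  simpa [Finset.sum_fn] using this

end Projection

/-! ### Variation of constants through Picard iterates of the adjoint equation -/

section LinearVariation

set_option linter.unusedSectionVars false

variable {E F : Type*} [NormedAddCommGroup E] [NormedSpace ℝ E] [NormedAddCommGroup F]
  [NormedSpace ℝ F]

theorem UBound.antideriv {k : ℕ} {f g : ℝ → ℝ → E}
    (hfg : ∀ᶠ h in 𝓝[>] (0 : ℝ), ∀ t ∈ Icc 0 h, HasDerivWithinAt (f h) (g h t) (Icc 0 h) t)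
    (h0 : ∀ᶠ h in 𝓝[>] (0 : ℝ), f h 0 = 0) (hg : UBound k g) : UBound (k + 1) f := by
  obtain ⟨M, hM, hg⟩ := hg
  refine ⟨M, hM, ?_⟩
  filter_upwards [hfg, h0, hg, eventually_pos] with h h1 h2 h3 hpos t ht
  have hb := norm_image_sub_le_of_norm_deriv_le_segment' h1
    (fun x hx => h3 x (Ico_subset_Icc_self hx)) t ht
  rw [h2, sub_zero, sub_zero] at hb
  refine hb.trans ?_
  rw [pow_succ, ← mul_assoc]
  have := hpos.le
  exact mul_le_mul_of_nonneg_left ht.2 (by positivity)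

theorem UBound.at_end {k : ℕ} {g : ℝ → ℝ → E} (hg : UBound k g) :
    UBound k (fun h _ => g h h) := by
  obtain ⟨M, hM, hg⟩ := hg
  refine ⟨M, hM, ?_⟩
  filter_upwards [hg, eventually_pos] with h h1 h0 t _
  exact h1 h ⟨h0.le, le_rfl⟩

theorem UBound.integral_to_end {k : ℕ} {g : ℝ → ℝ → E} (hg : UBound k g) :
    UBound (k + 1) (fun h t => ∫ u in t..h, g h u) := by
  obtain ⟨M, hM, hg⟩ := hg
  refine ⟨M, hM, ?_⟩
  filter_upwards [hg, eventually_pos] with h h1 h0 t ht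
  have hb := intervalIntegral.norm_integral_le_of_norm_le_const (a := t) (b := h)
    (f := g h) (C := M * h ^ k) fun u hu => by
      rw [uIoc_of_le ht.2] at hu
      exact h1 u ⟨ht.1.trans hu.1.le, hu.2⟩
  refine hb.trans ?_
  rw [pow_succ, ← mul_assoc, abs_of_nonneg (sub_nonneg.2 ht.2)]
  have := h0.le
  exact mul_le_mul_of_nonneg_left (by linarith [ht.1]) (by positivity)

/-- The Picard iterates of the adjoint problem `W' = -W A`, `W(h) = 1`. -/
noncomputable def adjointPicard (A : ℝ → E →L[ℝ] E) : ℕ → ℝ → ℝ → E →L[ℝ] E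
  | 0 => fun _ _ => ContinuousLinearMap.id ℝ E
  | n + 1 => fun h t =>
      ContinuousLinearMap.id ℝ E + ∫ u in t..h, (adjointPicard A n h u).comp (A u)

variable {A : ℝ → E →L[ℝ] E}

theorem continuous_adjointPicard [CompleteSpace E] (hA : Continuous A) (n : ℕ) (h : ℝ) :
    Continuous (adjointPicard A n h) := by
  induction n with
  | zero => exact continuous_const
  | succ n ih =>
    have hc : Continuous fun u => (adjointPicard A n h u).comp (A u) := ih.clm_comp hA
    refine continuous_const.add ?_
    simp only [intervalIntegral.integral_symm h]
    exact (intervalIntegral.continuous_primitive (fun a b => hc.intervalIntegrable a b) h).neg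

theorem hasDerivAt_adjointPicard_succ [CompleteSpace E] (hA : Continuous A) (n : ℕ) (h t : ℝ) :
    HasDerivAt (adjointPicard A (n + 1) h) (-(adjointPicard A n h t).comp (A t)) t := by
  have hc : Continuous fun u => (adjointPicard A n h u).comp (A u) :=
    (continuous_adjointPicard hA n h).clm_comp hA
  exact (intervalIntegral.integral_hasDerivAt_left (hc.intervalIntegrable _ _)
    (hc.stronglyMeasurableAtFilter _ _) hc.continuousAt).const_add _

theorem adjointPicard_self (n : ℕ) (h : ℝ) :
    adjointPicard A n h h = ContinuousLinearMap.id ℝ E := by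
  cases n <;> simp [adjointPicard]

theorem uBound_adjointPicard (hA : UBound 0 fun _ t => A t) (n : ℕ) :
    UBound 0 (adjointPicard A n) := by
  induction n with
  | zero => exact UBound.const _
  | succ n ih =>
    have := (ih.bilin (ContinuousLinearMap.compL ℝ E E E) hA).integral_to_end
    exact (UBound.const _).add (this.mono (Nat.zero_le _))

/-- The iterates are one order smoother than `A`. This matters because `f` of class `C^s` gives `A =
f'(y)` only order `s - 1`, while the cancellation needs order `s`. -/
theorem uTaylor_adjointPicard [CompleteSpace E] (hA : Continuous A) {k : ℕ}
    (hT : UTaylor k fun _ t => A t) (n : ℕ) : UTaylor (k + 1) (adjointPicard A n) := by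
  induction n with
  | zero => exact UTaylor.const _ (UBound.const _)
  | succ n ih =>
    refine UTaylor.antideriv (g := fun h t => -(adjointPicard A n h t).comp (A t))
      (Eventually.of_forall fun h t _ => (hasDerivAt_adjointPicard_succ hA n h t).hasDerivWithinAt)
      (uBound_adjointPicard hT.bounded (n + 1)).at_endpoint ?_
    exact ((ih.mono k.le_succ).bilin (ContinuousLinearMap.compL ℝ E E E) hT).neg

/-- Each difference is the integral of the previous one times `A` over an interval of length at most
`h`, gaining one power. -/
theorem adjointPicard_succ_sub [CompleteSpace E] (hA : Continuous A)
    (hA0 : UBound 0 fun _ t => A t) (n : ℕ) :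
    UBound (n + 1) (fun h t => adjointPicard A (n + 1) h t - adjointPicard A n h t) := by
  induction n with
  | zero =>
    have := (((uBound_adjointPicard hA0 0).bilin
      (ContinuousLinearMap.compL ℝ E E E) hA0)).integral_to_end
    refine this.congr (Eventually.of_forall fun h t _ => ?_)
    exact add_sub_cancel_left _ _
  | succ n ih =>
    refine (ih.bilin (ContinuousLinearMap.compL ℝ E E E) hA0).integral_to_end.congr
      (Eventually.of_forall fun h t _ => ?_)
    have hc := fun n => ((continuous_adjointPicard hA n h).clm_comp hA).intervalIntegrable
      (μ := MeasureTheory.volume) t h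
    simp only [map_sub, sub_apply, ContinuousLinearMap.compL_apply]
    rw [intervalIntegral.integral_sub (hc _) (hc _)]
    exact add_sub_add_left_eq_sub _ _ _

/-- If `e' = A e + r + q` and `e(0) = 0`, with `e = O(h^k)` and `q = O(h^l)`, then `e(h)` is
controlled by the pairing of `r` with a Picard iterate of the adjoint problem. -/
theorem UBound.endpoint_of_linear_ode [CompleteSpace E] (hA : Continuous A)
    (hA0 : UBound 0 fun _ t => A t) {e r q : ℝ → ℝ → E} {k l n N : ℕ}
    (he : ∀ᶠ h in 𝓝[>] (0 : ℝ), ∀ t ∈ Icc 0 h,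
      HasDerivWithinAt (e h) (A t (e h t) + r h t + q h t) (Icc 0 h) t)
    (he0 : ∀ᶠ h in 𝓝[>] (0 : ℝ), e h 0 = 0) (hr : UCont r) (hqc : UCont q)
    (hek : UBound k e) (hq : UBound l q) (hNk : N ≤ n + 1 + k) (hNl : N ≤ l)
    (hW : UBound N fun h _ => ∫ c in (0 : ℝ)..1,
      adjointPicard A (n + 1) h (c * h) (r h (c * h))) :
    UBound (N + 1) (fun h _ => e h h) := by
  have hec : UCont e := UCont.of_hasDeriv he
  have h1 : UBound N (fun h t =>
      (adjointPicard A (n + 1) h t - adjointPicard A n h t) (A t (e h t))) :=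
    UBound.mono (k := n + 1 + (0 + k)) (by omega)
      ((adjointPicard_succ_sub hA hA0 n).bilin (ContinuousLinearMap.id ℝ (E →L[ℝ] E))
        (hA0.bilin (ContinuousLinearMap.id ℝ (E →L[ℝ] E)) hek))
  have h2 : UBound N (fun h t => adjointPicard A (n + 1) h t (q h t)) :=
    UBound.mono (k := 0 + l) (by omega)
      ((uBound_adjointPicard hA0 (n + 1)).bilin (ContinuousLinearMap.id ℝ (E →L[ℝ] E)) hq)
  -- The factor `h` from rescaling `[0,h]` to `[0,1]` raises the order from `N` to `N + 1`.
  have h3 := (UBound.pow 1).at_end.smul (hW.add (h1.add h2).integral)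
  rw [add_comm 1 N] at h3
  refine h3.congr ?_
  filter_upwards [he, he0, hr, hqc, hec, eventually_pos] with h h1 h2 h3 h4 h5 h0 t _
  have hWc := fun n => (continuous_adjointPicard hA n h).continuousOn (s := Icc 0 h)
  have hcr : ContinuousOn (fun t => adjointPicard A (n + 1) h t (r h t)) (Icc 0 h) :=
    (hWc _).clm_apply h3
  have hcq : ContinuousOn (fun t =>
      (adjointPicard A (n + 1) h t - adjointPicard A n h t) (A t (e h t)) +
      adjointPicard A (n + 1) h t (q h t)) (Icc 0 h) :=
    (((hWc _).sub (hWc _)).clm_apply (hA.continuousOn.clm_apply h5)).add ((hWc _).clm_apply h4)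
  -- Since the derivative of iterate `n + 1` involves iterate `n`, the terms in `A e` do not cancel
  -- exactly: the difference of consecutive iterates remains.
  have hd : ∀ t ∈ Icc 0 h, HasDerivWithinAt (fun t => adjointPicard A (n + 1) h t (e h t))
      (adjointPicard A (n + 1) h t (r h t) +
        ((adjointPicard A (n + 1) h t - adjointPicard A n h t) (A t (e h t)) +
        adjointPicard A (n + 1) h t (q h t))) (Icc 0 h) t := by
    intro t ht
    refine ((hasDerivAt_adjointPicard_succ hA n h t).hasDerivWithinAt.clm_apply
      (h1 t ht)).congr_deriv ?_
    simp only [map_add, sub_apply, neg_apply, ContinuousLinearMap.comp_apply]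
    abel
  have hftc := intervalIntegral.integral_eq_sub_of_hasDerivAt_of_le h0.le
    (fun t ht => (hd t ht).continuousWithinAt)
    (fun t ht => (hd t (Ioo_subset_Icc_self ht)).hasDerivAt (Icc_mem_nhds ht.1 ht.2))
    (ContinuousOn.intervalIntegrable (by rw [uIcc_of_le h0.le]; exact hcr.add hcq))
  rw [adjointPicard_self, h2, map_zero, sub_zero, ContinuousLinearMap.id_apply] at hftc
  rw [← hftc, pow_one, ← intervalIntegral.integral_add (intervalIntegrable_rescaled h0 hcr)
    (intervalIntegrable_rescaled h0 hcq),
    intervalIntegral.smul_integral_comp_mul_right (fun t => adjointPicard A (n + 1) h t (r h t) +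
        ((adjointPicard A (n + 1) h t - adjointPicard A n h t) (A t (e h t)) +
        adjointPicard A (n + 1) h t (q h t)))]
  simp

end LinearVariation

/-! ### From residual estimates to the endpoint error -/

section ResidualError

universe u

variable {E : Type u} [NormedAddCommGroup E] [NormedSpace ℝ E]

/-- The derivative is Lipschitz near `x₀`; apply the mean value inequality on the segment from `z`
to `x`. -/
theorem exists_quadratic_remainder_bound {f : E → E} {x₀ : E} (hf : ContDiffAt ℝ 2 f x₀) :
    ∃ C : ℝ, 0 ≤ C ∧ ∃ U ∈ 𝓝 x₀, ∀ x ∈ U, ∀ z ∈ U,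
      ‖f x - f z - fderiv ℝ f z (x - z)‖ ≤ C * ‖x - z‖ * ‖x - z‖ := by
  obtain ⟨K, U, hU, hL⟩ := (hf.fderiv_right (m := 1) (by norm_num)).exists_lipschitzOnWith
  have hd : ∀ᶠ x in 𝓝 x₀, DifferentiableAt ℝ f x :=
    (hf.eventually (by norm_num)).mono fun x hx => hx.differentiableAt (by norm_num)
  obtain ⟨ρ, hρ, hball⟩ := Metric.mem_nhds_iff.1 (inter_mem hU hd)
  refine ⟨K, K.2, Metric.ball x₀ ρ, Metric.ball_mem_nhds _ hρ, fun x hx z hz => ?_⟩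
  have hseg : segment ℝ z x ⊆ Metric.ball x₀ ρ := (convex_ball x₀ ρ).segment_subset hz hx
  refine Convex.norm_image_sub_le_of_norm_fderiv_le' (𝕜 := ℝ) (fun w hw => (hball (hseg hw)).2)
    (fun w hw => ?_) (convex_segment z x) (left_mem_segment ℝ z x) (right_mem_segment ℝ z x)
  refine (hL.norm_sub_le (hball (hseg hw)).1 (hball hz).1).trans ?_
  exact mul_le_mul_of_nonneg_left (norm_sub_le_of_mem_segment hw) K.2

theorem UBound.eventually_mem {k : ℕ} {x : ℝ → ℝ → E} {x₀ : E}
    (hx : UBound (k + 1) fun h t => x h t - x₀) {U : Set E} (hU : U ∈ 𝓝 x₀) :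
    ∀ᶠ h in 𝓝[>] (0 : ℝ), ∀ t ∈ Icc 0 h, x h t ∈ U := by
  obtain ⟨ρ, hρ, hball⟩ := Metric.mem_nhds_iff.1 hU
  obtain ⟨M, hM, hx⟩ := hx.mono (l := 1) (by omega)
  filter_upwards [hx, eventually_pos, eventually_lt (show 0 < ρ / (M + 1) by positivity)]
    with h h1 h0 h2 t ht
  refine hball (mem_ball_iff_norm.2 ((h1 t ht).trans_lt ?_))
  rw [lt_div_iff₀ (by positivity)] at h2
  nlinarith

theorem UBound.comp_sub_of_lipschitz {f : E → E} {x₀ : E} (hf : ContDiffAt ℝ 1 f x₀)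
    {k : ℕ} {x z : ℝ → ℝ → E} (hx : UBound 1 fun h t => x h t - x₀)
    (hz : UBound 1 fun h t => z h t - x₀) (hxz : UBound k fun h t => x h t - z h t) :
    UBound k fun h t => f (x h t) - f (z h t) := by
  obtain ⟨K, U, hU, hL⟩ := hf.exists_lipschitzOnWith
  obtain ⟨M, hM, hxz⟩ := hxz
  refine ⟨K * M, mul_nonneg K.2 hM, ?_⟩
  filter_upwards [hx.eventually_mem hU, hz.eventually_mem hU, hxz] with h h1 h2 h3 t ht
  refine (hL.norm_sub_le (h1 t ht) (h2 t ht)).trans ?_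
  rw [mul_assoc]
  exact mul_le_mul_of_nonneg_left (h3 t ht) K.2

theorem UBound.quadratic_remainder {f : E → E} {x₀ : E} (hf : ContDiffAt ℝ 2 f x₀)
    {k : ℕ} {x z : ℝ → ℝ → E} (hx : UBound 1 fun h t => x h t - x₀)
    (hz : UBound 1 fun h t => z h t - x₀) (hxz : UBound k fun h t => x h t - z h t) :
    UBound (k + k) fun h t =>
      f (x h t) - f (z h t) - fderiv ℝ f (z h t) (x h t - z h t) := by
  obtain ⟨C, hC, U, hU, hL⟩ := exists_quadratic_remainder_bound hf
  obtain ⟨M, hM, hxz⟩ := hxz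
  refine ⟨C * M * M, by positivity, ?_⟩
  filter_upwards [hx.eventually_mem hU, hz.eventually_mem hU, hxz, eventually_pos]
    with h h1 h2 h3 h0 t ht
  refine (hL _ (h1 t ht) _ (h2 t ht)).trans ?_
  calc C * ‖x h t - z h t‖ * ‖x h t - z h t‖ ≤ C * (M * h ^ k) * (M * h ^ k) := by
        gcongr
        · exact h3 t ht
        · exact h3 t ht
    _ = C * M * M * h ^ (k + k) := by ring

/-- Since `f(y)` is the derivative of `y`, its expansions of orders below `j` yield the one of order
`j` through `UTaylor.comp`. -/
theorem uTaylor_solution {Ω : Set E} (hΩ : IsOpen Ω) {f : E → E} {s : ℕ}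
    (hf : ContDiffOn ℝ s f Ω) {T : ℝ} (hT : 0 < T) {y : ℝ → E} (hyΩ : ∀ t ∈ Icc 0 T, y t ∈ Ω)
    (hy : ∀ t ∈ Icc 0 T, HasDerivWithinAt y (f (y t)) (Icc 0 T) t)
    {F : Type u} [NormedAddCommGroup F] [NormedSpace ℝ F] {k : ℕ} (hk : k ≤ s) {g : E → F}
    (hg : ContDiffOn ℝ k g Ω) : UTaylor k (fun _ t => g (y t)) := by
  have hK : IsCompact (y '' Icc 0 T) :=
    isCompact_Icc.image_of_continuousOn fun t ht => (hy t ht).continuousWithinAt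
  have hKΩ : y '' Icc 0 T ⊆ Ω := by
    rintro _ ⟨t, ht, rfl⟩
    exact hyΩ t ht
  have hyK : ∀ᶠ h in 𝓝[>] (0 : ℝ), ∀ t ∈ Icc 0 h, y t ∈ y '' Icc 0 T := by
    filter_upwards [eventually_lt hT] with h h1 t ht
    exact mem_image_of_mem y ⟨ht.1, ht.2.trans h1.le⟩
  have hyd : ∀ᶠ h in 𝓝[>] (0 : ℝ), ∀ t ∈ Icc 0 h, HasDerivWithinAt y (f (y t)) (Icc 0 h) t := by
    filter_upwards [eventually_lt hT] with h h1 t ht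
    exact (hy t ⟨ht.1, ht.2.trans h1.le⟩).mono (Icc_subset_Icc_right h1.le)
  have hy' : ∀ j ≤ s, UTaylor j (fun _ t => f (y t)) := by
    intro j
    induction j using Nat.strong_induction_on with
    | _ j ih =>
      intro hj
      exact UTaylor.comp hΩ hK hKΩ hyK hyd (hf.of_le (by exact_mod_cast hj))
        fun i hi => ih i hi (by omega)
  exact UTaylor.comp hΩ hK hKΩ hyK hyd hg fun j hj => hy' j (by omega)

/-- If the residual of the family `σ` in `y' = f(y)` is `O(h^s)`, and `O(h^{2s})` when paired with
families smooth to order `s`, then the endpoint error is `O(h^{2s+1})`. -/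
theorem endpoint_error_of_residual [CompleteSpace E] {Ω : Set E} (hΩ : IsOpen Ω) {f : E → E}
    {s : ℕ} (hs : 1 ≤ s) (hf : ContDiffOn ℝ s f Ω) {y₀ : E} {T : ℝ} (hT : 0 < T) {y : ℝ → E}
    (hy₀ : y 0 = y₀) (hyΩ : ∀ t ∈ Icc 0 T, y t ∈ Ω)
    (hy : ∀ t ∈ Icc 0 T, HasDerivWithinAt y (f (y t)) (Icc 0 T) t) {σ D : ℝ → ℝ → E}
    (hσ₀ : ∀ᶠ h in 𝓝[>] (0 : ℝ), σ h 0 = y₀)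
    (hσ : ∀ᶠ h in 𝓝[>] (0 : ℝ), ∀ t ∈ Icc 0 h, HasDerivWithinAt (σ h) (D h t) (Icc 0 h) t)
    (hD : UBound 0 D) (hr : UBound s fun h t => D h t - f (σ h t))
    (hrc : UCont fun h t => D h t - f (σ h t))
    (hpair : ∀ W : ℝ → ℝ → E →L[ℝ] E, UTaylor s W → UCont W → UBound (2 * s) fun h _ =>
      ∫ c in (0 : ℝ)..1, W h (c * h) (D h (c * h) - f (σ h (c * h)))) :
    UBound (2 * s + 1) fun h _ => σ h h - y h := by
  obtain ⟨k, rfl⟩ : ∃ k, s = k + 1 := ⟨s - 1, by omega⟩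
  have hy₀Ω : y₀ ∈ Ω := hy₀ ▸ hyΩ 0 ⟨le_rfl, hT.le⟩
  have hf0 : ContDiffAt ℝ (k + 1 : ℕ) f y₀ := hf.contDiffAt (hΩ.mem_nhds hy₀Ω)
  have hf1 : ContDiffAt ℝ 1 f y₀ := hf0.of_le (by exact_mod_cast (by omega : 1 ≤ k + 1))
  have hyd : ∀ᶠ h in 𝓝[>] (0 : ℝ), ∀ t ∈ Icc 0 h,
      HasDerivWithinAt y (f (y t)) (Icc 0 h) t := by
    filter_upwards [eventually_lt hT] with h h1 t ht
    exact (hy t ⟨ht.1, ht.2.trans h1.le⟩).mono (Icc_subset_Icc_right h1.le)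
  have hfy : UBound 0 fun _ t => f (y t) := (uTaylor_solution hΩ hf hT hyΩ hy le_rfl hf).bounded
  have hσ1 : UBound 1 fun h t => σ h t - y₀ :=
    UBound.antideriv (hσ.mono fun h h1 t ht => (h1 t ht).sub_const y₀)
      (hσ₀.mono fun h h1 => by rw [h1, sub_self]) hD
  have hy1 : UBound 1 fun _ t => y t - y₀ :=
    UBound.antideriv (hyd.mono fun h h1 t ht => (h1 t ht).sub_const y₀)
      (Eventually.of_forall fun h => by rw [hy₀, sub_self]) hfy
  have he0 : ∀ᶠ h in 𝓝[>] (0 : ℝ), σ h 0 - y 0 = 0 :=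
    hσ₀.mono fun h h1 => by rw [h1, hy₀, sub_self]
  have hed : ∀ᶠ h in 𝓝[>] (0 : ℝ), ∀ t ∈ Icc 0 h, HasDerivWithinAt (fun t => σ h t - y t)
      (D h t - f (y t)) (Icc 0 h) t := by
    filter_upwards [hσ, hyd] with h h1 h2 t ht
    exact (h1 t ht).sub (h2 t ht)
  -- Bootstrap in place of Gronwall: `e' = r + (f(σ) - f(y))` with `f` Lipschitz near `y₀`, so each
  -- integration gains a power of `h` until the order `s` of the residual limits it, at `s + 1 = k +
  -- 2`.
  have he : ∀ j ≤ k + 2, UBound j fun h t => σ h t - y t := by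
    intro j
    induction j with
    | zero =>
      intro _
      refine ((hσ1.sub hy1).mono (Nat.zero_le _)).congr (Eventually.of_forall fun h t _ => ?_)
      abel
    | succ j ih =>
      intro hj
      have h1 := (hr.mono (show j ≤ k + 1 by omega)).add
        (UBound.comp_sub_of_lipschitz hf1 hσ1 hy1 (ih (by omega)))
      exact UBound.antideriv hed he0 (h1.congr (Eventually.of_forall fun h t _ => by abel))
  have hfdc : ContDiffOn ℝ k (fderiv ℝ f) Ω := hf.fderiv_of_isOpen hΩ (by norm_cast)
  -- Clamping time to `[0,T]` makes `A` continuous on the whole line, as the Picard iterates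
  -- require.
  let A : ℝ → E →L[ℝ] E := fun u => fderiv ℝ f (y (projIcc 0 T hT.le u))
  have hyc : ContinuousOn y (Icc 0 T) := fun t ht => (hy t ht).continuousWithinAt
  have hA : Continuous A :=
    (hfdc.continuousOn.comp hyc hyΩ).comp_continuous
      (continuous_subtype_val.comp continuous_projIcc) fun u => (projIcc 0 T hT.le u).2
  have hAeq : ∀ᶠ h in 𝓝[>] (0 : ℝ), ∀ t ∈ Icc 0 h, A t = fderiv ℝ f (y t) := by
    filter_upwards [eventually_lt hT] with h h1 t ht
    simp only [A, projIcc_of_mem hT.le ⟨ht.1, ht.2.trans h1.le⟩]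
  have hAT : UTaylor k fun _ t => A t :=
    (uTaylor_solution hΩ hf hT hyΩ hy (show k ≤ k + 1 by omega) hfdc).congr hAeq
  have hq : UBound (2 * (k + 1)) fun h t => f (σ h t) - f (y t) - A t (σ h t - y t) := by
    -- For `s = 1`, `f` is only `C¹` and has no quadratic remainder bound, but `e = O(h²)` already
    -- makes each term `O(h^{2s})`.
    rcases Nat.eq_zero_or_pos k with rfl | hk
    · exact (UBound.comp_sub_of_lipschitz hf1 hσ1 hy1 (he 2 le_rfl)).sub
        (hAT.bounded.bilin (ContinuousLinearMap.id ℝ (E →L[ℝ] E)) (he 2 le_rfl))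
    · have h2 := UBound.quadratic_remainder
        (hf0.of_le (by exact_mod_cast (by omega : 2 ≤ k + 1))) hσ1 hy1 (he (k + 1) (by omega))
      rw [← two_mul] at h2
      refine h2.congr ?_
      filter_upwards [hAeq] with h h1 t ht
      rw [h1 t ht]
  have hyΩ' : ∀ᶠ h in 𝓝[>] (0 : ℝ), ∀ t ∈ Icc 0 h, y t ∈ Ω := by
    filter_upwards [eventually_lt hT] with h h1 t ht
    exact hyΩ t ⟨ht.1, ht.2.trans h1.le⟩
  have hσc : UCont σ := UCont.of_hasDeriv hσ
  have hyc' : UCont fun _ t => y t := UCont.of_hasDeriv hyd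
  have hqc : UCont fun h t => f (σ h t) - f (y t) - A t (σ h t - y t) :=
    ((hσc.comp (UBound.eventually_mem (k := 0) hσ1 (hΩ.mem_nhds hy₀Ω)) hf.continuousOn).sub
      (hyc'.comp hyΩ' hf.continuousOn)).sub
      (UCont.bilin (ContinuousLinearMap.id ℝ (E →L[ℝ] E)) (g := fun _ t => A t)
        (Eventually.of_forall fun _ => hA.continuousOn) (hσc.sub hyc'))
  -- The Picard defect times `e` has order `(k + 2) + (k + 2)`, which exceeds the required `2 * (k +
  -- 1)`.
  refine UBound.endpoint_of_linear_ode (e := fun h t => σ h t - y t) (n := k + 1) (k := k + 2)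
    hA hAT.bounded (hed.mono fun h h1 t ht => (h1 t ht).congr_deriv ?_) he0 hrc hqc
    (he (k + 2) le_rfl) hq (by omega) le_rfl
    (hpair _ (uTaylor_adjointPicard hA hAT _)
      (Eventually.of_forall fun h => (continuous_adjointPicard hA _ h).continuousOn))
  abel

end ResidualError

/-! ### Orders of the Casimir numerator and of the residual -/

section Pairings

variable {E F V : Type*} [NormedAddCommGroup E] [NormedSpace ℝ E] [NormedAddCommGroup F]
  [NormedSpace ℝ F] [NormedAddCommGroup V] [InnerProductSpace ℝ V]

theorem UBound.clm_apply {k l : ℕ} {b : ℝ → ℝ → E →L[ℝ] F} {u : ℝ → ℝ → E} (hb : UBound k b)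
    (hu : UBound l u) : UBound (k + l) fun h t => b h t (u h t) :=
  hb.bilin (ContinuousLinearMap.id ℝ (E →L[ℝ] F)) hu

theorem UTaylor.clm_apply {k : ℕ} {b : ℝ → ℝ → E →L[ℝ] F} {u : ℝ → ℝ → E} (hb : UTaylor k b)
    (hu : UTaylor k u) : UTaylor k fun h t => b h t (u h t) :=
  hb.bilin (ContinuousLinearMap.id ℝ (E →L[ℝ] F)) hu

theorem UCont.clm_apply {b : ℝ → ℝ → E →L[ℝ] F} {u : ℝ → ℝ → E} (hb : UCont b)
    (hu : UCont u) : UCont fun h t => b h t (u h t) :=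
  hb.bilin (ContinuousLinearMap.id ℝ (E →L[ℝ] F)) hu

/-- This folds the double sum of the method into two nested projections: summing over `j` rebuilds
the truncated expansion of `u` under the integral. -/
theorem sum_integral_clm_apply_legendreCoeff [CompleteSpace E] [CompleteSpace F] (i s : ℕ)
    {b : ℝ → ℝ → E →L[ℝ] F} (u : ℝ → ℝ → E) {h : ℝ} (h0 : 0 < h)
    (hb : ContinuousOn (b h) (Icc 0 h)) :
    ∑ j ∈ Finset.range s, (∫ c in (0 : ℝ)..1, (legendreP i c * legendreP j c) • b h (c * h))
        (legendreCoeff j u h) =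
      legendreCoeff i (fun h t => b h t (legendreProj s u h t)) h := by
  have hint : ∀ j, IntervalIntegrable
      (fun c => (legendreP i c * legendreP j c) • b h (c * h)) MeasureTheory.volume 0 1 :=
    fun j => intervalIntegrable_smul_rescaled (q := fun c => legendreP i c * legendreP j c) h0
      ((continuous_legendreP i).mul (continuous_legendreP j)) hb
  rw [legendreCoeff]
  simp only [legendreProj_rescaled s _ h0, map_sum, map_smul, Finset.smul_sum, smul_smul]
  rw [intervalIntegral.integral_finsetSum]
  · refine Finset.sum_congr rfl fun j _ => ?_
    rw [ContinuousLinearMap.intervalIntegral_apply (hint j)]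
    rfl
  · intro j _
    exact ⟨(ContinuousLinearMap.apply ℝ F (legendreCoeff j u h)).integrable_comp (hint j).1,
      (ContinuousLinearMap.apply ℝ F (legendreCoeff j u h)).integrable_comp (hint j).2⟩

theorem integral_inner_legendreProj [CompleteSpace V] (s : ℕ) {g : ℝ → ℝ → V} (v : ℝ → ℝ → V)
    {h : ℝ} (h0 : 0 < h) (hg : ContinuousOn (g h) (Icc 0 h)) :
    ∫ c in (0 : ℝ)..1, ⟪g h (c * h), legendreProj s v h (c * h)⟫_ℝ =
      ∑ i ∈ Finset.range s, ⟪legendreCoeff i v h, legendreCoeff i g h⟫_ℝ := by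
  simp only [real_inner_comm (legendreCoeff _ g h)]
  exact integral_bilin_legendreProj (innerSL ℝ) s v h0 hg

/-- If `⟪v, b w⟫ = 0` for all `w`, the pairing of the truncated expansion of `v` with `b` times
the truncated expansion of `u` is `O(h^{2s})`. -/
theorem uBound_integral_inner_legendreProj [CompleteSpace V] {s : ℕ} {b : ℝ → ℝ → V →L[ℝ] V}
    {u v : ℝ → ℝ → V} (hbv : ∀ᶠ h in 𝓝[>] (0 : ℝ), ∀ t ∈ Icc 0 h, ∀ w, ⟪v h t, b h t w⟫_ℝ = 0)
    (hb : UTaylor s b) (hbc : UCont b) (hu : UTaylor s u) (huc : UCont u) (hv : UTaylor s v)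
    (hvc : UCont v) :
    UBound (2 * s) fun h _ => ∫ c in (0 : ℝ)..1,
      ⟪b h (c * h) (legendreProj s u h (c * h)), legendreProj s v h (c * h)⟫_ℝ := by
  have key := (hb.clm_apply (hu.legendreProj le_rfl huc)).integral_bilin_of_orthogonal (innerSL ℝ)
    (hbc.clm_apply (UCont.legendreProj s u)) (hv.sub_legendreProj le_rfl hvc)
    (hvc.sub (UCont.legendreProj s _)) (by
      filter_upwards [hvc, eventually_pos] with h h1 h0 i hi
      exact integral_pow_smul_sub_legendreProj hi h0 h1)
  refine key.neg.congr ?_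
  filter_upwards [hbv, eventually_pos] with h h1 h0 t _
  rw [← intervalIntegral.integral_neg]
  refine intervalIntegral.integral_congr fun c hc => ?_
  rw [uIcc_of_le zero_le_one] at hc
  have hz := h1 _ (mul_mem_Icc h0 hc) (legendreProj s u h (c * h))
  rw [real_inner_comm] at hz
  change _ = -⟪b h (c * h) (legendreProj s u h (c * h)),
    v h (c * h) - legendreProj s v h (c * h)⟫_ℝ
  rw [inner_sub_right, hz, zero_sub, neg_neg]

theorem UBound.integral_inner {g v : ℝ → ℝ → V} (hg : UBound 0 g) (hv : UBound 0 v) :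
    UBound 0 fun h _ => ∫ c in (0 : ℝ)..1, ⟪g h (c * h), v h (c * h)⟫_ℝ :=
  (hg.bilin (innerSL ℝ) hv).integral

/-- The truncation of `b u`, with `u` replaced by its own truncation, differs from `b u` by a family
whose pairing with families smooth to order `s` is `O(h^{2s})`. -/
theorem uBound_integral_residual [CompleteSpace E] {s : ℕ} {b W : ℝ → ℝ → E →L[ℝ] E}
    {u : ℝ → ℝ → E} {d : ℝ → E} (hd : UBound (2 * s) fun h _ => d h)
    (hb : UTaylor s b) (hbc : UCont b) (hu : UTaylor s u) (huc : UCont u)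
    (hW : UTaylor s W) (hWc : UCont W) :
    UBound (2 * s) fun h _ => ∫ c in (0 : ℝ)..1, W h (c * h)
      (legendreProj s (fun h t => b h t (legendreProj s u h t)) h (c * h) - d h -
        b h (c * h) (u h (c * h))) := by
  have orth : ∀ {g : ℝ → ℝ → E}, UCont g → ∀ᶠ h in 𝓝[>] (0 : ℝ), ∀ i < s,
      ∫ c in (0 : ℝ)..1, c ^ i • (g h (c * h) - legendreProj s g h (c * h)) = 0 := by
    intro g hg
    filter_upwards [hg, eventually_pos] with h h1 h0 i hi
    exact integral_pow_smul_sub_legendreProj hi h0 h1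
  have hfc := hbc.clm_apply huc
  have hRc := huc.sub (UCont.legendreProj s u)
  -- With `P` the projection, the residual is `-(bu - P(bu)) - P(b(u - Pu)) - d`. The first term is
  -- a projection error paired with `W`. In the second, self-adjointness moves `P` onto `W`, leaving
  -- the projection error `u - Pu` paired with `(PW) b`.
  have k1 := hW.integral_bilin_of_orthogonal (ContinuousLinearMap.id ℝ (E →L[ℝ] E)) hWc
    ((hb.clm_apply hu).sub_legendreProj le_rfl hfc) (hfc.sub (UCont.legendreProj s _)) (orth hfc)
  have k2 := ((hW.legendreProj le_rfl hWc).bilin (ContinuousLinearMap.compL ℝ E E E)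
    hb).integral_bilin_of_orthogonal (ContinuousLinearMap.id ℝ (E →L[ℝ] E))
    ((UCont.legendreProj s W).bilin (ContinuousLinearMap.compL ℝ E E E) hbc)
    (hu.sub_legendreProj le_rfl huc) hRc (orth huc)
  have k3 := (hW.bounded.clm_apply hd).integral
  rw [zero_add] at k3
  refine ((k1.add k2).add k3).neg.congr ?_
  filter_upwards [hWc, hbc, hfc, hRc, eventually_pos] with h c1 c2 c4 c5 h0 t _
  have cP : ∀ g : ℝ → ℝ → E, ContinuousOn (legendreProj s g h) (Icc 0 h) := fun g =>
    (continuous_legendreProj s g h).continuousOn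
  have cbR : ContinuousOn (fun t => b h t (u h t - legendreProj s u h t)) (Icc 0 h) :=
    c2.clm_apply c5
  have sw := integral_bilin_legendreProj_comm (ContinuousLinearMap.id ℝ (E →L[ℝ] E)) s (g := W)
    (f := fun h t => b h t (u h t - legendreProj s u h t)) h0 c1 cbR
  have i1 := intervalIntegrable_rescaled h0 (c1.clm_apply (c4.fun_sub (cP fun h t => b h t (u h t))))
  have i2 := intervalIntegrable_rescaled h0
    (c1.clm_apply (cP fun h t => b h t (u h t - legendreProj s u h t)))
  have i3 := intervalIntegrable_rescaled h0 (c1.clm_apply (continuousOn_const (c := d h)))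
  have sub := legendreProj_sub s (g := fun h t => b h t (u h t))
    (f := fun h t => b h t (legendreProj s u h t)) h0 c4 (c2.clm_apply (cP u))
  simp only [← map_sub] at sub
  simp only [ContinuousLinearMap.id_apply, ContinuousLinearMap.compL_apply,
    ContinuousLinearMap.comp_apply] at sw ⊢
  rw [← sw, ← intervalIntegral.integral_add i1 i2,
    ← intervalIntegral.integral_add (i1.add i2) i3, ← intervalIntegral.integral_neg]
  refine intervalIntegral.integral_congr fun c _ => ?_
  simp only [sub, ← map_add, ← map_neg]
  congr 1
  abel

theorem uBound_residual [CompleteSpace E] {s : ℕ} {b : ℝ → ℝ → E →L[ℝ] E}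
    {u : ℝ → ℝ → E} {d : ℝ → E} (hd : UBound s fun h _ => d h)
    (hb : UTaylor s b) (hbc : UCont b) (hu : UTaylor s u) (huc : UCont u) :
    UBound s fun h t => legendreProj s (fun h t => b h t (legendreProj s u h t)) h t - d h -
        b h t (u h t) := by
  have hp := hu.legendreProj le_rfl huc
  have hpc := UCont.legendreProj s u
  have h1 := (hb.clm_apply hp).sub_legendreProj le_rfl (hbc.clm_apply hpc)
  have h2 := hb.bounded.clm_apply (hu.sub_legendreProj le_rfl huc)
  rw [zero_add] at h2
  refine ((h1.add h2).add hd).neg.congr (Eventually.of_forall fun h t _ => ?_)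
  rw [map_sub]
  abel

theorem uBound_div_of_le {k : ℕ} {a b : ℝ → ℝ} (ha : UBound k fun h _ => a h) {δ : ℝ} (hδ : 0 < δ)
    (hb : ∀ᶠ h in 𝓝[>] (0 : ℝ), δ ≤ |b h|) : UBound k fun h _ => a h / b h := by
  obtain ⟨M, hM, ha⟩ := ha
  refine ⟨M / δ, by positivity, ?_⟩
  filter_upwards [ha, hb, eventually_pos] with h h1 h2 h0 t ht
  rw [norm_div, div_mul_eq_mul_div]
  exact div_le_div₀ (by have := h0.le; positivity) (h1 t ht) hδ h2

end Pairings

/-! ### The method written with projections -/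

section Method

variable {m : ℕ}

theorem contDiffOn_gradient {Ω : Set (EuclideanSpace ℝ (Fin m))} (hΩ : IsOpen Ω) {s : ℕ}
    {H : EuclideanSpace ℝ (Fin m) → ℝ} (hH : ContDiffOn ℝ (s + 1) H Ω) :
    ContDiffOn ℝ s (∇ H) Ω := by
  let L : (EuclideanSpace ℝ (Fin m) →L[ℝ] ℝ) →L[ℝ] EuclideanSpace ℝ (Fin m) :=
    { toFun := (InnerProductSpace.toDual ℝ _).symm
      map_add' := map_add _
      map_smul' := fun c x => by simp
      cont := (InnerProductSpace.toDual ℝ _).symm.continuous }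
  exact L.contDiff.comp_contDiffOn (hH.fderiv_of_isOpen hΩ le_rfl)

variable {B : EuclideanSpace ℝ (Fin m) → EuclideanSpace ℝ (Fin m) →L[ℝ] EuclideanSpace ℝ (Fin m)}
  {H C : EuclideanSpace ℝ (Fin m) → ℝ}
  {Btilde : EuclideanSpace ℝ (Fin m) →L[ℝ] EuclideanSpace ℝ (Fin m)}

theorem gradCoeff_eq_legendreCoeff (G : EuclideanSpace ℝ (Fin m) → ℝ) (j : ℕ) (h : ℝ)
    (σ : ℝ → ℝ → EuclideanSpace ℝ (Fin m)) :
    gradCoeff G j h (σ h) = legendreCoeff j (fun h t => ∇ G (σ h t)) h := rfl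

theorem sum_rhoCoeff_gradCoeff (i s : ℕ) {h : ℝ} (h0 : 0 < h)
    {σ : ℝ → ℝ → EuclideanSpace ℝ (Fin m)}
    (hB : ContinuousOn (fun t => B (σ h t)) (Icc 0 h)) :
    ∑ j ∈ Finset.range s, rhoCoeff B i j h (σ h) (gradCoeff H j h (σ h)) =
      legendreCoeff i (fun h t => B (σ h t) (legendreProj s (fun h t => ∇ H (σ h t)) h t)) h :=
  sum_integral_clm_apply_legendreCoeff i s (b := fun h t => B (σ h t))
    (fun h t => ∇ H (σ h t)) h0 hB

theorem alphaNum_eq_integral (s : ℕ) {h : ℝ} (h0 : 0 < h)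
    {σ : ℝ → ℝ → EuclideanSpace ℝ (Fin m)}
    (hB : ContinuousOn (fun t => B (σ h t)) (Icc 0 h)) :
    alphaNum B H C s h (σ h) = ∫ c in (0 : ℝ)..1,
      ⟪B (σ h (c * h)) (legendreProj s (fun h t => ∇ H (σ h t)) h (c * h)),
        legendreProj s (fun h t => ∇ C (σ h t)) h (c * h)⟫_ℝ := by
  have hBp : ContinuousOn (fun t => B (σ h t) (legendreProj s (fun h t => ∇ H (σ h t)) h t))
      (Icc 0 h) := hB.clm_apply (continuous_legendreProj s _ h).continuousOn
  rw [integral_inner_legendreProj s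
    (g := fun h t => B (σ h t) (legendreProj s (fun h t => ∇ H (σ h t)) h t)) _ h0 hBp, alphaNum]
  refine Finset.sum_congr rfl fun i _ => ?_
  rw [← inner_sum, sum_rhoCoeff_gradCoeff i s h0 hB, gradCoeff_eq_legendreCoeff]

theorem IsPerturbedPath.hasDerivWithinAt {s : ℕ} {y₀ : EuclideanSpace ℝ (Fin m)} {h α : ℝ}
    {σ : ℝ → ℝ → EuclideanSpace ℝ (Fin m)} (h0 : 0 < h)
    (hσ : IsPerturbedPath B H Btilde s y₀ h α (σ h))
    (hB : ContinuousOn (fun t => B (σ h t)) (Icc 0 h)) {t : ℝ} (ht : t ∈ Icc 0 h) :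
    HasDerivWithinAt (σ h) (legendreProj s
      (fun h t => B (σ h t) (legendreProj s (fun h t => ∇ H (σ h t)) h t)) h t -
        α • Btilde (legendreCoeff 0 (fun h t => ∇ H (σ h t)) h)) (Icc 0 h) t := by
  have h1 := hσ.2 (t / h) ⟨div_nonneg ht.1 h0.le, (div_le_one h0).2 ht.2⟩
  rw [div_mul_cancel₀ _ h0.ne'] at h1
  refine h1.congr_deriv ?_
  rw [gradCoeff_eq_legendreCoeff, legendreProj]
  congr 1
  refine Finset.sum_congr rfl fun i _ => ?_
  rw [← Finset.smul_sum, sum_rhoCoeff_gradCoeff i s h0 hB]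

end Method

end PoissonHBVM

/-! ### The order of the method -/

theorem mainTheorem10 {m : ℕ} (s : ℕ) (hs : 1 ≤ s)
    (Ω : Set (EuclideanSpace ℝ (Fin m))) (hΩ : IsOpen Ω)
    (B : EuclideanSpace ℝ (Fin m) → EuclideanSpace ℝ (Fin m) →L[ℝ] EuclideanSpace ℝ (Fin m))
    (H C : EuclideanSpace ℝ (Fin m) → ℝ)
    (hB : ContDiffOn ℝ s B Ω) (hH : ContDiffOn ℝ (s + 1) H Ω) (hC : ContDiffOn ℝ (s + 1) C Ω)
    (hskew : ∀ x ∈ Ω, PoissonHBVM.IsSkew (B x))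
    (hcas : PoissonHBVM.IsCasimirOn B C Ω)
    (Btilde : EuclideanSpace ℝ (Fin m) →L[ℝ] EuclideanSpace ℝ (Fin m))
    (hBtilde : PoissonHBVM.IsSkew Btilde)
    -- the exact solution of the Poisson problem
    (y₀ : EuclideanSpace ℝ (Fin m)) (T : ℝ) (hT : 0 < T) (y : ℝ → EuclideanSpace ℝ (Fin m))
    (hy₀ : y 0 = y₀) (hyΩ : ∀ t ∈ Icc 0 T, y t ∈ Ω)
    (hy : ∀ t ∈ Icc 0 T, HasDerivWithinAt y (B (y t) (∇ H (y t))) (Icc 0 T) t)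
    -- for each step-size, the parameter and the path produced by the method
    (α : ℝ → ℝ) (σ : ℝ → ℝ → EuclideanSpace ℝ (Fin m))
    (hσ : ∀ᶠ h in 𝓝[>] (0 : ℝ),
      PoissonHBVM.IsPerturbedPath B H Btilde s y₀ h (α h) (σ h))
    (hα : ∀ᶠ h in 𝓝[>] (0 : ℝ),
      α h = PoissonHBVM.alphaNum B H C s h (σ h) / PoissonHBVM.alphaDenom H C Btilde h (σ h))
    -- the paths stay in a fixed compact part of the domain as the step-size tends to zero
    (K : Set (EuclideanSpace ℝ (Fin m))) (hK : IsCompact K) (hKΩ : K ⊆ Ω)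
    (hσK : ∀ᶠ h in 𝓝[>] (0 : ℝ), ∀ t ∈ Icc 0 h, σ h t ∈ K)
    -- the denominator is non-zero, uniformly as the step-size tends to zero
    (δ : ℝ) (hδ : 0 < δ)
    (hdenom : ∀ᶠ h in 𝓝[>] (0 : ℝ), δ ≤ |PoissonHBVM.alphaDenom H C Btilde h (σ h)|) :
    (fun h => σ h h - y h) =O[𝓝[>] (0 : ℝ)] (fun h => h ^ (2 * s + 1)) := by
  have hG := PoissonHBVM.contDiffOn_gradient hΩ hH
  have hGC := PoissonHBVM.contDiffOn_gradient hΩ hC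
  have hf : ContDiffOn ℝ s (fun x => B x (∇ H x)) Ω := hB.clm_apply hG
  have hσΩ : ∀ᶠ h in 𝓝[>] (0 : ℝ), ∀ t ∈ Icc 0 h, σ h t ∈ Ω :=
    hσK.mono fun h h1 t ht => hKΩ (h1 t ht)
  have hσc : PoissonHBVM.UCont σ := by
    filter_upwards [hσ, PoissonHBVM.eventually_pos] with h h1 h0 t ht
    have h2 := h1.2 (t / h) ⟨div_nonneg ht.1 h0.le, (div_le_one h0).2 ht.2⟩
    rw [div_mul_cancel₀ _ h0.ne'] at h2
    exact h2.continuousWithinAt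
  have hBc := hσc.comp hσΩ hB.continuousOn
  have hHc := hσc.comp hσΩ hG.continuousOn
  have hCc := hσc.comp hσΩ hGC.continuousOn
  set D : ℝ → ℝ → EuclideanSpace ℝ (Fin m) := fun h t => PoissonHBVM.legendreProj s
      (fun h t => B (σ h t) (PoissonHBVM.legendreProj s (fun h t => ∇ H (σ h t)) h t)) h t -
        α h • Btilde (PoissonHBVM.legendreCoeff 0 (fun h t => ∇ H (σ h t)) h) with hD
  have hσD : ∀ᶠ h in 𝓝[>] (0 : ℝ), ∀ t ∈ Icc 0 h,
      HasDerivWithinAt (σ h) (D h t) (Icc 0 h) t := by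
    filter_upwards [hσ, hBc, PoissonHBVM.eventually_pos] with h h1 h2 h0 t ht
    exact h1.hasDerivWithinAt h0 h2 ht
  -- Order zero requires nothing of `D`: it is boundedness on the compact set `K`, and it starts the
  -- bootstrap.
  have hB0 : PoissonHBVM.UTaylor 0 fun h t => B (σ h t) :=
    PoissonHBVM.UTaylor.comp hΩ hK hKΩ hσK hσD (hB.of_le (by simp)) (by simp)
  have hH0 : PoissonHBVM.UTaylor 0 fun h t => ∇ H (σ h t) :=
    PoissonHBVM.UTaylor.comp hΩ hK hKΩ hσK hσD (hG.of_le (by simp)) (by simp)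
  have hC0 : PoissonHBVM.UTaylor 0 fun h t => ∇ C (σ h t) :=
    PoissonHBVM.UTaylor.comp hΩ hK hKΩ hσK hσD (hGC.of_le (by simp)) (by simp)
  have hnum : ∀ᶠ h in 𝓝[>] (0 : ℝ), ∀ t ∈ Icc 0 h, PoissonHBVM.alphaNum B H C s h (σ h) =
      ∫ c in (0 : ℝ)..1, ⟪B (σ h (c * h)) (PoissonHBVM.legendreProj s
        (fun h t => ∇ H (σ h t)) h (c * h)),
        PoissonHBVM.legendreProj s (fun h t => ∇ C (σ h t)) h (c * h)⟫_ℝ := by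
    filter_upwards [hBc, PoissonHBVM.eventually_pos] with h h1 h0 t _
    exact PoissonHBVM.alphaNum_eq_integral s h0 h1
  have hαk : ∀ {k : ℕ}, (PoissonHBVM.UBound k fun h _ =>
      PoissonHBVM.alphaNum B H C s h (σ h)) → PoissonHBVM.UBound k fun h _ => α h := fun hk =>
    (PoissonHBVM.uBound_div_of_le hk hδ hdenom).congr (hα.mono fun h h1 t _ => h1)
  -- Crude boundedness of `α` must come first: the bound `O(h^{2s})` needs the smoothness of `σ`,
  -- which is obtained from an equation containing `α`.
  have hα0 : PoissonHBVM.UBound 0 fun h _ => α h := by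
    have h1 := hB0.bounded.clm_apply (hH0.bounded.legendreProj s)
    exact hαk ((h1.integral_inner (hC0.bounded.legendreProj s)).congr hnum)
  have hd : ∀ {k : ℕ}, (PoissonHBVM.UBound k fun h _ => α h) → PoissonHBVM.UBound k fun h _ =>
      α h • Btilde (PoissonHBVM.legendreCoeff 0 (fun h t => ∇ H (σ h t)) h) := fun hk =>
    hk.smul ((PoissonHBVM.UBound.const Btilde).clm_apply (hH0.bounded.legendreCoeff 0))
  -- Orders of `D` below `k` give order `k` for `B(σ)` and `∇H(σ)`, and then for `D`. The
  -- perturbation is constant in `t`, so its boundedness is enough at every order.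
  have hDk : ∀ k ≤ s, PoissonHBVM.UTaylor k D := by
    intro k
    induction k using Nat.strong_induction_on with
    | _ k ih =>
      intro hk
      have hD' : ∀ j < k, PoissonHBVM.UTaylor j D := fun j hj => ih j hj (by omega)
      have hBk : PoissonHBVM.UTaylor k fun h t => B (σ h t) :=
        PoissonHBVM.UTaylor.comp hΩ hK hKΩ hσK hσD (hB.of_le (by exact_mod_cast hk)) hD'
      have hHk : PoissonHBVM.UTaylor k fun h t => ∇ H (σ h t) :=
        PoissonHBVM.UTaylor.comp hΩ hK hKΩ hσK hσD (hG.of_le (by exact_mod_cast hk)) hD'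
      exact ((hBk.clm_apply (hHk.legendreProj hk hHc)).legendreProj hk
        (hBc.clm_apply (PoissonHBVM.UCont.legendreProj s _))).sub
        (PoissonHBVM.UTaylor.const k (hd hα0))
  have hD' : ∀ j < s, PoissonHBVM.UTaylor j D := fun j hj => hDk j hj.le
  have hBs : PoissonHBVM.UTaylor s fun h t => B (σ h t) :=
    PoissonHBVM.UTaylor.comp hΩ hK hKΩ hσK hσD hB hD'
  have hHs : PoissonHBVM.UTaylor s fun h t => ∇ H (σ h t) :=
    PoissonHBVM.UTaylor.comp hΩ hK hKΩ hσK hσD hG hD'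
  have hCs : PoissonHBVM.UTaylor s fun h t => ∇ C (σ h t) :=
    PoissonHBVM.UTaylor.comp hΩ hK hKΩ hσK hσD hGC hD'
  have hα2 : PoissonHBVM.UBound (2 * s) fun h _ => α h :=
    hαk ((PoissonHBVM.uBound_integral_inner_legendreProj
      (hσΩ.mono fun h h1 t ht w => hcas _ (h1 t ht) w) hBs hBc hHs hHc hCs hCc).congr hnum)
  have hDc : PoissonHBVM.UCont D := Eventually.of_forall fun h =>
    ((PoissonHBVM.continuous_legendreProj s _ h).sub continuous_const).continuousOn
  have hmain := PoissonHBVM.endpoint_error_of_residual hΩ hs hf hT hy₀ hyΩ hy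
    (hσ.mono fun h h1 => h1.1) hσD (hDk 0 (Nat.zero_le s)).bounded
    (PoissonHBVM.uBound_residual (hd (hα2.mono (by omega))) hBs hBc hHs hHc)
    (hDc.sub (hBc.clm_apply hHc))
    (fun W hW hWc => PoissonHBVM.uBound_integral_residual (hd hα2) hBs hBc hHs hHc hW hWc)
  obtain ⟨M, hM, hmain⟩ := hmain
  refine IsBigO.of_bound M ?_
  filter_upwards [hmain, PoissonHBVM.eventually_pos] with h h1 h0
  rw [norm_pow, Real.norm_of_nonneg h0.le]
  exact h1 0 ⟨le_rfl, h0.le⟩
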